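/- By a $\mathbb{Q}$-algebra we mean a commutative ring $E$ (with $1$; the zero ring is allowed) containing $\mathbb{Q}$ as scalars and of finite dimension as a vector space over $\mathbb{Q}$. An element $\alpha\in E$ is called separable if $f(\alpha)=0$ for some $f\in\mathbb{Q}[X]$ that is coprime to its derivative $f'$; the set $E_{\mathrm{sep}}$ of separable elements is a sub-$\mathbb{Q}$-algebra of $E$. For $\alpha\in E$ let $\mathbb{Q}[\alpha]$ be the subalgebra of $E$ generated by $\alpha$; $\alpha$ is a primitive element for $E$ if $\mathbb{Q}[\alpha]=E$. **Theorem.** For every $\mathbb{Q}$-algebra $E$, the subalgebra $E_{\mathrm{sep}}$ has a primitive element. In addition, there is a deterministic polynomial-time algorithm that, given a $\mathbb{Q}$-algebra $E$, produces $\alpha\in E$ with $E_{\mathrm{sep}}=\mathbb{Q}[\alpha]$. Here $E$ is given by its structure constants $a_{ijk}\in\mathbb{Q}$ $(1\le i,j,k\le n=\dim_{\mathbb{Q}}E)$ on an arbitrary $\mathbb{Q}$-basis $e_1,\dots,e_n$ of $E$, where $e_ie_j=\sum_k a_{ijk}e_k$. The output $\alpha$ is given by its coordinates on that basis. Rational numbers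 are written as fractions in lowest terms with binary numerator and denominator. Polynomial time means that the running time, measured in bit operations up to a polynomial, is bounded by a fixed polynomial in the length of the input. -/

import Mathlib

open Polynomial

universe u

/-! ### The separable subalgebra -/

/-- An element `x` of a `ℚ`-algebra is separable if it is a zero of some polynomial over `ℚ`
that is coprime to its derivative. -/
def IsSeparableElt {E : Type u} [CommRing E] [Algebra ℚ E] (x : E) : Prop :=
  ∃ f : ℚ[X], IsCoprime f (derivative f) ∧ aeval x f = 0

/-- For finite-dimensional `E`, an element is separable if and only if multiplication by it is
a semisimple endomorphism of `E`. -/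
theorem isSeparableElt_iff_isSemisimple {E : Type u} [CommRing E] [Algebra ℚ E]
    [FiniteDimensional ℚ E] (x : E) :
    IsSeparableElt x ↔ (Algebra.lmul ℚ E x).IsSemisimple := by
  constructor
  · rintro ⟨f, hf, hx⟩
    refine Module.End.isSemisimple_of_squarefree_aeval_eq_zero
      (Polynomial.Separable.squarefree hf) ?_
    rw [aeval_algHom_apply, hx, map_zero]
  · intro h
    refine ⟨minpoly ℚ x, ?_, minpoly.aeval ℚ x⟩
    have h1 := h.minpoly_squarefree
    rw [minpoly.algHom_eq _ Algebra.lmul_injective] at h1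
    exact PerfectField.separable_iff_squarefree.mpr h1

/-- `E_sep`: the set of separable elements of `E`, which is a sub-`ℚ`-algebra of `E`. -/
def sepSubalgebra (E : Type u) [CommRing E] [Algebra ℚ E] [FiniteDimensional ℚ E] :
    Subalgebra ℚ E where
  carrier := {x | IsSeparableElt x}
  mul_mem' := by
    intro x y hx hy
    rw [Set.mem_ofPred_eq, isSeparableElt_iff_isSemisimple] at *
    rw [map_mul]
    exact hx.mul_of_commute ((Commute.all x y).map (Algebra.lmul ℚ E)) hy
  add_mem' := by
    intro x y hx hy
    rw [Set.mem_ofPred_eq, isSeparableElt_iff_isSemisimple] at *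
    rw [map_add]
    exact hx.add_of_commute ((Commute.all x y).map (Algebra.lmul ℚ E)) hy
  algebraMap_mem' := fun r =>
    ⟨X - C r, Polynomial.separable_X_sub_C, by simp⟩

/-- `α` is a primitive element for the `ℚ`-algebra `A` if `ℚ[α] = A`. -/
def IsPrimitiveElt {A : Type u} [CommRing A] [Algebra ℚ A] (α : A) : Prop :=
  Algebra.adjoin ℚ {α} = ⊤

/-! ### A model of computation with bit cost

Deterministic while-programs over Lisp-like data: binary trees whose leaves are integers.
Every evaluation of an operation is charged the bit sizes of its operands and of its result,
so up to a polynomial the cost is the running time on a Turing machine. -/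

/-- The data on which programs work: integers and pairs of data. -/
inductive Data : Type
  | int (z : ℤ) : Data
  | pair (a b : Data) : Data

namespace Data

/-- The size of a datum: one unit for every node of the tree,
and for every leaf also the number of binary digits of the integer there. -/
def size : Data → ℕ
  | int z => 1 + z.natAbs.size
  | pair a b => 1 + a.size + b.size

/-- The integer `0` also serves as the empty list and as the truth value "false". -/
def nil : Data := int 0

/-- The truth value of a proposition. -/
def ofProp (p : Prop) [Decidable p] : Data := if p then int 1 else int 0

/-- First component of a pair (`nil` for an integer). -/
def fst : Data → Data
  | int _ => nil
  | pair a _ => a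

/-- Second component of a pair (`nil` for an integer). -/
def snd : Data → Data
  | int _ => nil
  | pair _ b => b

/-- The integer at a leaf (`0` for a pair). -/
def toInt : Data → ℤ
  | int z => z
  | pair _ _ => 0

/-- Is the datum a pair? -/
def isPair : Data → Data
  | int _ => int 0
  | pair _ _ => int 1

/-- A list, as nested pairs that end in `nil`. -/
def ofList : List Data → Data
  | [] => nil
  | a :: l => pair a (ofList l)

/-- A rational number, as the pair of its numerator and denominator in lowest terms. -/
def ofRat (q : ℚ) : Data := pair (int q.num) (int q.den)

/-- A vector of rational numbers, as the list of its coordinates. -/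
def ofVec {n : ℕ} (v : Fin n → ℚ) : Data := ofList (List.ofFn fun i => ofRat (v i))

/-- A three-dimensional array of rational numbers, as a list of lists of vectors. -/
def ofArray {n : ℕ} (a : Fin n → Fin n → Fin n → ℚ) : Data :=
  ofList (List.ofFn fun i => ofList (List.ofFn fun j => ofVec (a i j)))

end Data

/-- A store assigns a datum to every program variable. A program mentions only finitely many. -/
abbrev Store : Type := ℕ → Data

/-- Expressions: variables, integer constants, the operations on pairs,
integer arithmetic, and comparison of integers. -/
inductive Expr : Type
  | var (x : ℕ) : Expr
  | const (z : ℤ) : Expr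
  | pair (e f : Expr) : Expr
  | fst (e : Expr) : Expr
  | snd (e : Expr) : Expr
  | isPair (e : Expr) : Expr
  | add (e f : Expr) : Expr
  | sub (e f : Expr) : Expr
  | mul (e f : Expr) : Expr
  | div (e f : Expr) : Expr
  | le (e f : Expr) : Expr

namespace Expr

/-- The value of an expression. Division is integer division with remainder. -/
def eval (σ : Store) : Expr → Data
  | var x => σ x
  | const z => .int z
  | pair e f => .pair (e.eval σ) (f.eval σ)
  | fst e => (e.eval σ).fst
  | snd e => (e.eval σ).snd
  | isPair e => (e.eval σ).isPair
  | add e f => .int ((e.eval σ).toInt + (f.eval σ).toInt)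
  | sub e f => .int ((e.eval σ).toInt - (f.eval σ).toInt)
  | mul e f => .int ((e.eval σ).toInt * (f.eval σ).toInt)
  | div e f => .int ((e.eval σ).toInt / (f.eval σ).toInt)
  | le e f => .ofProp ((e.eval σ).toInt ≤ (f.eval σ).toInt)

/-- The cost of evaluating an expression: the sum, over all its subexpressions
(itself included), of the sizes of their values. -/
def cost (σ : Store) : Expr → ℕ
  | var x => (σ x).size
  | const z => (Data.int z).size
  | pair e f => (eval σ (pair e f)).size + e.cost σ + f.cost σ
  | fst e => (eval σ (fst e)).size + e.cost σ
  | snd e => (eval σ (snd e)).size + e.cost σ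
  | isPair e => (eval σ (isPair e)).size + e.cost σ
  | add e f => (eval σ (add e f)).size + e.cost σ + f.cost σ
  | sub e f => (eval σ (sub e f)).size + e.cost σ + f.cost σ
  | mul e f => (eval σ (mul e f)).size + e.cost σ + f.cost σ
  | div e f => (eval σ (div e f)).size + e.cost σ + f.cost σ
  | le e f => (eval σ (le e f)).size + e.cost σ + f.cost σ

end Expr

/-- Programs: no operation, assignment, sequential composition, conditional, while-loop. -/
inductive Program : Type
  | skip : Program
  | assign (x : ℕ) (e : Expr) : Program
  | seq (c d : Program) : Program
  | cond (e : Expr) (c d : Program) : Program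
  | loop (e : Expr) (c : Program) : Program

namespace Program

/-- `Runs c σ τ t`: started in the store `σ`, the program `c` halts in the store `τ`
after time `t`. A condition holds if its value is different from the integer `0`. -/
inductive Runs : Program → Store → Store → ℕ → Prop
  | skip (σ : Store) : Runs skip σ σ 1
  | assign (x : ℕ) (e : Expr) (σ : Store) :
      Runs (assign x e) σ (Function.update σ x (e.eval σ)) (1 + e.cost σ)
  | seq {c d : Program} {σ τ υ : Store} {s t : ℕ} :
      Runs c σ τ s → Runs d τ υ t → Runs (seq c d) σ υ (1 + s + t)
  | cond_true {e : Expr} {c d : Program} {σ τ : Store} {t : ℕ} :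
      e.eval σ ≠ Data.int 0 → Runs c σ τ t → Runs (cond e c d) σ τ (1 + e.cost σ + t)
  | cond_false {e : Expr} {c d : Program} {σ τ : Store} {t : ℕ} :
      e.eval σ = Data.int 0 → Runs d σ τ t → Runs (cond e c d) σ τ (1 + e.cost σ + t)
  | loop_true {e : Expr} {c : Program} {σ τ υ : Store} {s t : ℕ} :
      e.eval σ ≠ Data.int 0 → Runs c σ τ s → Runs (loop e c) τ υ t →
      Runs (loop e c) σ υ (1 + e.cost σ + s + t)
  | loop_false {e : Expr} {c : Program} {σ : Store} :
      e.eval σ = Data.int 0 → Runs (loop e c) σ σ (1 + e.cost σ)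

/-- Programs are deterministic: the final store and the running time are determined by the
initial store. -/
theorem Runs.unique {c : Program} {σ τ τ' : Store} {s s' : ℕ} (h : c.Runs σ τ s) (h' : c.Runs σ τ' s') :
   τ = τ' ∧ s = s' := by
  induction h generalizing τ' s' with
  | skip => cases h'; simp
  | assign => cases h'; simp
  | seq _ _ i1 i2 =>
    cases h' with | seq a b =>
    obtain ⟨rfl, rfl⟩ := i1 a; obtain ⟨rfl, rfl⟩ := i2 b; simp
  | cond_true h _ i => cases h' with
    | cond_true _ a => obtain ⟨rfl, rfl⟩ := i a; simp
    | cond_false => contradiction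
  | cond_false h _ i => cases h' with
    | cond_true _ a => contradiction
    | cond_false _ a => obtain ⟨rfl, rfl⟩ := i a; simp
  | loop_true h _ _ i1 i2 => cases h' with
    | loop_true _ a b => obtain ⟨rfl, rfl⟩ := i1 a; obtain ⟨rfl, rfl⟩ := i2 b; simp
    | loop_false => contradiction
  | loop_false h => cases h' with
    | loop_true _ a b => contradiction
    | loop_false => simp

/-- The initial store: the input is in variable `0`, all other variables hold `nil`. -/
def initStore (input : Data) : Store := fun x => if x = 0 then input else Data.nil

/-- On the given input, the program halts after time `t` with the given output in
variable `0`. -/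
def Computes (c : Program) (input output : Data) (t : ℕ) : Prop :=
  ∃ τ : Store, Runs c (initStore input) τ t ∧ τ 0 = output

end Program

/-! ### Algebras as input -/

/-- The structure constants `a i j k` of `E` on the basis `e`:
`e i * e j = ∑ k, a i j k • e k`. -/
noncomputable def structureConstants {E : Type u} [CommRing E] [Algebra ℚ E] {n : ℕ}
    (e : Module.Basis (Fin n) ℚ E) (i j k : Fin n) : ℚ :=
  e.repr (e i * e j) k

/-!
Why the theorem holds. Let `f` be the given basis multiplied by a common denominator of the
structure constants. Then the structure constants of `f` are integers, so every homomorphism from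
`E` to the algebraic numbers maps the `f i` to algebraic integers, all of whose conjugates are
bounded by the sum `B` of the absolute values of these integers (`norm_scaled_le`).

*Digits.* If `d 0, …, d (N - 1)` are algebraic integers all of whose conjugates are smaller than
the integer `k`, then `∑ i, k ^ i * d i = 0` forces all `d i` to vanish
(`eq_zero_of_sum_pow_mul_eq_zero`). With `k = 2 * B + 1`, applied to differences of values of two
homomorphisms, this shows that `β = ∑ i, k ^ i • f i` takes different values under different
homomorphisms.

*From `β` to a separable element.* Let `χ` be the characteristic polynomial of multiplication by
`β`. If `χ` divides the derivative of `G`, then `G(β)` is separable, because around every zero of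
`χ` the polynomial `G` is constant to an order higher than the multiplicity of the zero
(`isSeparableElt_aeval_of_dvd_derivative`). So neither factorization nor Newton iteration is needed
to get rid of the nilpotent part of `β`. The antiderivatives of `χ * X ^ m`, for `m ≤ n`, together
separate the zeros of `χ` (`Polynomial.exists_antiderivative_eval_ne`), and a second application of
the principle of digits shows that a single combination `G` of them does so, with powers of an
explicit integer as coefficients. The computed element is `α = G(β)`. It is separable, and
different homomorphisms take different values on it. Since `ℚ[α] ⊆ E_sep`, counting homomorphisms
to the algebraic numbers gives equality (`sepSubalgebra_eq_adjoin`):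
`dim E_sep ≤ dim E / nil ≤ #Hom(E) ≤ #Hom(ℚ[α]) ≤ dim ℚ[α]`.

*Running time.* All numbers that occur are given by sums, products and exact quotients of integers,
apart from two recursions: the coordinates of the powers of `β`, and the coefficients of `χ`, which
are found from the traces of the powers of `β` by Newton's identities
(`Matrix.sub_mul_coeff_charpoly`). No linear system is solved. The predicate `PolyTimeOn` of
uniform computability in polynomial time is closed under these constructions; only for the two
recursions the size of the intermediate results has to be estimated
(`RatArray.sum_abs_powCoord_le`, `abs_newtonCoeff_le`).
-/

/-! ### Sizes of data -/

namespace Data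

theorem size_fst_le (d : Data) : d.fst.size ≤ d.size := by
  cases d <;> simp [fst, size, nil]; try omega

theorem size_snd_le (d : Data) : d.snd.size ≤ d.size := by
  cases d <;> simp [snd, size, nil]

theorem size_ofProp_le (p : Prop) [Decidable p] : (ofProp p).size ≤ 2 := by
  unfold ofProp; split_ifs <;> simp [size]

end Data

theorem Nat.size_add_le (a b : ℕ) : (a + b).size ≤ a.size + b.size + 1 := by
  rw [Nat.size_le]
  have ha := Nat.lt_size_self a
  have hb := Nat.lt_size_self b
  have h1 : 2 ^ a.size ≤ 2 ^ (a.size + b.size) := Nat.pow_le_pow_right (by norm_num) (by omega)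
  have h2 : 2 ^ b.size ≤ 2 ^ (a.size + b.size) := Nat.pow_le_pow_right (by norm_num) (by omega)
  rw [pow_succ]; omega

theorem Nat.size_mul_le (a b : ℕ) : (a * b).size ≤ a.size + b.size := by
  rw [Nat.size_le, pow_add]
  exact Nat.mul_lt_mul'' (Nat.lt_size_self a) (Nat.lt_size_self b)

theorem Nat.size_le_self (a : ℕ) : a.size ≤ a := by
  rw [Nat.size_le]; exact Nat.lt_two_pow_self

namespace Data

theorem size_int_le_of_natAbs_le {y z : ℤ} (h : y.natAbs ≤ z.natAbs) :
    (int y).size ≤ (int z).size := by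
  simpa [size] using Nat.size_le_size h

theorem size_int_le_of_abs_le {y z : ℤ} (h : |y| ≤ z) : (int y).size ≤ (int z).size :=
  size_int_le_of_natAbs_le (by rw [Int.abs_eq_natAbs] at h; omega)

theorem size_int_add_le (y z : ℤ) : (int (y + z)).size ≤ (int y).size + (int z).size := by
  have h1 := Nat.size_le_size (Int.natAbs_add_le y z)
  have h2 := Nat.size_add_le y.natAbs z.natAbs
  simp only [size]; omega

theorem size_int_neg (z : ℤ) : (int (-z)).size = (int z).size := by simp [size]

theorem size_int_sub_le (y z : ℤ) : (int (y - z)).size ≤ (int y).size + (int z).size := by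
  simpa [sub_eq_add_neg, size_int_neg] using size_int_add_le y (-z)

theorem size_int_mul_le (y z : ℤ) : (int (y * z)).size ≤ (int y).size + (int z).size := by
  have h2 := Nat.size_mul_le y.natAbs z.natAbs
  simp only [size, Int.natAbs_mul]; omega

theorem size_int_div_le (y z : ℤ) : (int (y / z)).size ≤ (int y).size :=
  size_int_le_of_natAbs_le (Int.natAbs_ediv_le_natAbs y z)

theorem size_int_natCast_le (k : ℕ) : (int k).size ≤ 1 + k := by
  simpa [size] using Nat.size_le_self k

end Data

namespace Expr

theorem size_eval_le_cost (σ : Store) (e : Expr) : (e.eval σ).size ≤ e.cost σ := by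
  cases e <;> simp only [cost, eval] <;> omega

end Expr

/-- Running time bounds the growth of every variable: a new value is charged when it is
assigned. -/
theorem Program.Runs.size_le {c : Program} {σ τ : Store} {t : ℕ} (h : c.Runs σ τ t) (x : ℕ) :
    (τ x).size ≤ (σ x).size + t := by
  induction h with
  | skip => omega
  | assign y e σ =>
    rcases eq_or_ne x y with rfl | hxy
    · have := e.size_eval_le_cost σ
      simp only [Function.update_self]; omega
    · simp [Function.update_of_ne hxy]
  | seq _ _ i1 i2 => omega
  | cond_true _ _ i => omega
  | cond_false _ _ i => omega
  | loop_true _ _ _ i1 i2 => omega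
  | loop_false => omega

/-! ### Polynomial-time computability -/

theorem Polynomial.eval_nat_mono (P : ℕ[X]) {a b : ℕ} (h : a ≤ b) : P.eval a ≤ P.eval b := by
  rw [Polynomial.eval_eq_sum, Polynomial.eval_eq_sum]
  exact Finset.sum_le_sum fun i _ => Nat.mul_le_mul_left _ (Nat.pow_le_pow_left h i)

/-- `PolyTimeOn s x y`: some program computes the datum `y p` from the datum `x p`, for all
parameters `p ∈ s` uniformly, in time polynomial in the size of `x p`. The program works from any
store that holds `x p` in variable `0`, and leaves all variables above some bound unchanged, so
that such programs can be combined. -/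
def PolyTimeOn {κ : Type*} (s : Set κ) (x y : κ → Data) : Prop :=
  ∃ (c : Program) (b : ℕ) (P : ℕ[X]), ∀ p ∈ s, ∀ σ : Store, σ 0 = x p →
    ∃ τ t, c.Runs σ τ t ∧ τ 0 = y p ∧ (∀ v, b < v → τ v = σ v) ∧ t ≤ P.eval (x p).size

/-- The natural numbers `N p`, for `p ∈ s`, are bounded by a polynomial in the size of `x p`. -/
def PolyBounded {κ : Type*} (s : Set κ) (x : κ → Data) (N : κ → ℕ) : Prop :=
  ∃ P : ℕ[X], ∀ p ∈ s, N p ≤ P.eval (x p).size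

namespace PolyBounded

variable {κ : Type*} {s : Set κ} {x : κ → Data} {M N : κ → ℕ}

theorem mono (hN : PolyBounded s x N) (h : ∀ p ∈ s, M p ≤ N p) : PolyBounded s x M :=
  let ⟨P, hP⟩ := hN
  ⟨P, fun p hp => (h p hp).trans (hP p hp)⟩

theorem const (k : ℕ) : PolyBounded s x (fun _ => k) := ⟨C k, fun p _ => by simp⟩

theorem size_self : PolyBounded s x (fun p => (x p).size) := ⟨X, fun p _ => by simp⟩

theorem add (hM : PolyBounded s x M) (hN : PolyBounded s x N) :
    PolyBounded s x (fun p => M p + N p) :=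
  let ⟨P, hP⟩ := hM
  let ⟨Q, hQ⟩ := hN
  ⟨P + Q, fun p hp => by simpa using Nat.add_le_add (hP p hp) (hQ p hp)⟩

theorem mul (hM : PolyBounded s x M) (hN : PolyBounded s x N) :
    PolyBounded s x (fun p => M p * N p) :=
  let ⟨P, hP⟩ := hM
  let ⟨Q, hQ⟩ := hN
  ⟨P * Q, fun p hp => by simpa using Nat.mul_le_mul (hP p hp) (hQ p hp)⟩

theorem eval (P : ℕ[X]) (hN : PolyBounded s x N) : PolyBounded s x (fun p => P.eval (N p)) :=
  let ⟨Q, hQ⟩ := hN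
  ⟨P.comp Q, fun p hp => by simpa using P.eval_nat_mono (hQ p hp)⟩

theorem trans {y : κ → Data} (hy : PolyBounded s x (fun p => (y p).size))
    (hN : PolyBounded s y N) : PolyBounded s x N :=
  let ⟨Q, hQ⟩ := hN
  (hy.eval Q).mono hQ

theorem comp {κ' : Type*} {s' : Set κ'} (hN : PolyBounded s x N) (g : κ' → κ)
    (hg : ∀ p ∈ s', g p ∈ s) : PolyBounded s' (fun p => x (g p)) (fun p => N (g p)) :=
  let ⟨Q, hQ⟩ := hN
  ⟨Q, fun p hp => hQ (g p) (hg p hp)⟩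

end PolyBounded

namespace PolyTimeOn

open Program

variable {κ : Type*} {s : Set κ} {x y z : κ → Data}

theorem congr (h : PolyTimeOn s x y) (hyz : ∀ p ∈ s, y p = z p) : PolyTimeOn s x z := by
  obtain ⟨c, b, P, H⟩ := h
  refine ⟨c, b, P, fun p hp σ hσ => ?_⟩
  rw [← hyz p hp]
  exact H p hp σ hσ

theorem comp {κ' : Type*} {s' : Set κ'} (h : PolyTimeOn s x y) (g : κ' → κ)
    (hg : ∀ p ∈ s', g p ∈ s) : PolyTimeOn s' (fun p => x (g p)) (fun p => y (g p)) := by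
  obtain ⟨c, b, P, H⟩ := h
  exact ⟨c, b, P, fun p hp σ hσ => H (g p) (hg p hp) σ hσ⟩

theorem size_le (h : PolyTimeOn s x y) : PolyBounded s x (fun p => (y p).size) := by
  obtain ⟨c, b, P, H⟩ := h
  refine ⟨X + P, fun p hp => ?_⟩
  obtain ⟨τ, t, h1, h2, -, h3⟩ := H p hp (fun _ => x p) rfl
  have := h1.size_le 0
  simp only [h2, eval_add, eval_X] at this ⊢
  omega

/-- Evaluation of a single expression of polynomially bounded cost. -/
theorem of_expr (e : Expr) (he : ∀ p ∈ s, ∀ σ : Store, σ 0 = x p → e.eval σ = y p)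
    {N : κ → ℕ} (hN : PolyBounded s x N)
    (hc : ∀ p ∈ s, ∀ σ : Store, σ 0 = x p → e.cost σ ≤ N p) : PolyTimeOn s x y := by
  obtain ⟨P, hP⟩ := hN
  refine ⟨.assign 0 e, 0, P + 1, fun p hp σ hσ => ⟨_, _, .assign 0 e σ, ?_, fun v hv => ?_, ?_⟩⟩
  · simp [he p hp σ hσ]
  · simp [Function.update_of_ne (Nat.pos_iff_ne_zero.mp hv)]
  · have h1 := hc p hp σ hσ
    have h2 := hP p hp
    simp only [eval_add, eval_one]; omega

theorem refl : PolyTimeOn s x x :=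
  of_expr (.var 0) (fun _ _ _ h => h) PolyBounded.size_self (fun _ _ _ h => by simp [Expr.cost, h])

theorem trans (h : PolyTimeOn s x y) (h' : PolyTimeOn s y z) : PolyTimeOn s x z := by
  obtain ⟨Q, hQ⟩ := h.size_le
  obtain ⟨c, b, P, H⟩ := h
  obtain ⟨c', b', P', H'⟩ := h'
  refine ⟨.seq c c', max b b', 1 + P + P'.comp Q, fun p hp σ hσ => ?_⟩
  obtain ⟨τ, t, h1, h2, h3, h4⟩ := H p hp σ hσ
  obtain ⟨υ, r, h1', h2', h3', h4'⟩ := H' p hp τ h2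
  refine ⟨υ, _, h1.seq h1', h2', fun v hv => ?_, ?_⟩
  · rw [h3' v (by omega), h3 v (by omega)]
  · have := P'.eval_nat_mono (hQ p hp)
    simp only [eval_add, eval_one, eval_comp] at this ⊢; omega

theorem pair (hy : PolyTimeOn s x y) (hz : PolyTimeOn s x z) :
    PolyTimeOn s x (fun p => .pair (y p) (z p)) := by
  obtain ⟨Q, hQ⟩ := hy.size_le
  obtain ⟨R, hR⟩ := hz.size_le
  obtain ⟨c, b, P, H⟩ := hy
  obtain ⟨c', b', P', H'⟩ := hz
  -- variable `u` keeps the input, variable `w` the first result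
  let u := max b b' + 1
  let w := max b b' + 2
  refine ⟨.seq (.assign u (.var 0)) (.seq c (.seq (.assign w (.var 0)) (.seq (.assign 0 (.var u))
    (.seq c' (.assign 0 (.pair (.var w) (.var 0))))))), w,
    12 + P + P' + 2 * X + 3 * Q + 2 * R, fun p hp σ hσ => ?_⟩
  obtain ⟨τ, t, h1, h2, h3, h4⟩ := H p hp (Function.update σ u (σ 0)) (by simp [u, hσ])
  have hu : τ u = x p := by rw [h3 u (by omega)]; simp [hσ]
  obtain ⟨τ', t', h1', h2', h3', h4'⟩ := H' p hp
    (Function.update (Function.update τ w (τ 0)) 0 (x p)) (by simp)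
  have hw : τ' w = y p := by
    rw [h3' w (by omega), Function.update_of_ne (by omega), Function.update_self, h2]
  refine ⟨_, _, .seq (.assign _ _ _) (.seq h1 (.seq (.assign _ _ _) (.seq (.assign _ _ _)
    (.seq (τ := τ') (s := t') ?_ (.assign _ _ _))))), ?_, fun v hv => ?_, ?_⟩
  · convert! h1' using 2
    simp [Expr.eval, w, u, ← hu]
  · simp [Expr.eval, hw, h2']
  · rw [Function.update_of_ne (by omega), h3' v (by omega), Function.update_of_ne (by omega),
      Function.update_of_ne (by omega), h3 v (by omega), Function.update_of_ne (by omega)]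
  · have e1 := hQ p hp
    have e2 := hR p hp
    have hu' : (Function.update τ w (τ 0)) u = x p := by
      rw [Function.update_of_ne (by omega), hu]
    simp only [Expr.cost, Expr.eval, hw, hσ, h2, h2', Data.size, eval_add, eval_mul,
      eval_X, eval_ofNat] at e1 e2 hu' ⊢
    rw [hu']
    omega

theorem const (d : Data) : PolyTimeOn s x (fun _ => d) := by
  induction d with
  | int k =>
    exact of_expr (.const k) (fun _ _ _ _ => rfl) (PolyBounded.const (Data.int k).size)
      (fun _ _ _ _ => le_rfl)
  | pair a b ha hb => exact ha.pair hb

theorem fst (h : PolyTimeOn s x y) : PolyTimeOn s x (fun p => (y p).fst) := by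
  refine h.trans (of_expr (.fst (.var 0)) (fun p _ σ hσ => by simp [Expr.eval, hσ])
    (PolyBounded.size_self.mul (PolyBounded.const 2)) fun p _ σ hσ => ?_)
  have := (y p).size_fst_le
  simp only [Expr.cost, Expr.eval, hσ]; omega

theorem snd (h : PolyTimeOn s x y) : PolyTimeOn s x (fun p => (y p).snd) := by
  refine h.trans (of_expr (.snd (.var 0)) (fun p _ σ hσ => by simp [Expr.eval, hσ])
    (PolyBounded.size_self.mul (PolyBounded.const 2)) fun p _ σ hσ => ?_)
  have := (y p).size_snd_le
  simp only [Expr.cost, Expr.eval, hσ]; omega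

end PolyTimeOn

/-- The integers `f p` are computable in polynomial time from the data `x p`, for `p ∈ s`. -/
abbrev PolyTimeInt {κ : Type*} (s : Set κ) (x : κ → Data) (f : κ → ℤ) : Prop :=
  PolyTimeOn s x (fun p => .int (f p))

namespace PolyTimeInt

variable {κ : Type*} {s : Set κ} {x : κ → Data} {f g : κ → ℤ}

/-- A binary operation of the language, applied to computable integers. -/
theorem binary (op : Expr → Expr → Expr) (o : ℤ → ℤ → Data)
    (heval : ∀ σ e e', (op e e').eval σ = o (e.eval σ).toInt (e'.eval σ).toInt)
    (hcost : ∀ σ e e', (op e e').cost σ = ((op e e').eval σ).size + e.cost σ + e'.cost σ)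
    (hsize : ∀ y z, (o y z).size ≤ (Data.int y).size + (Data.int z).size)
    (hf : PolyTimeInt s x f) (hg : PolyTimeInt s x g) :
    PolyTimeOn s x (fun p => o (f p) (g p)) := by
  refine (PolyTimeOn.pair hf hg).trans (PolyTimeOn.of_expr
    (op (.fst (.var 0)) (.snd (.var 0))) (fun p _ σ hσ => ?_)
    (PolyBounded.size_self.mul (PolyBounded.const 5)) fun p _ σ hσ => ?_)
  · simp [heval, Expr.eval, hσ, Data.fst, Data.snd, Data.toInt]
  · have := hsize (f p) (g p)
    simp only [hcost, heval, Expr.eval, hσ, Expr.cost, Data.fst, Data.snd, Data.toInt]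
    simp only [Data.size] at this ⊢
    omega

theorem const (k : ℤ) : PolyTimeInt s x (fun _ => k) := PolyTimeOn.const _

theorem add (hf : PolyTimeInt s x f) (hg : PolyTimeInt s x g) :
    PolyTimeInt s x (fun p => f p + g p) :=
  binary .add (fun y z => .int (y + z)) (fun _ _ _ => rfl) (fun _ _ _ => rfl)
    Data.size_int_add_le hf hg

theorem sub (hf : PolyTimeInt s x f) (hg : PolyTimeInt s x g) :
    PolyTimeInt s x (fun p => f p - g p) :=
  binary .sub (fun y z => .int (y - z)) (fun _ _ _ => rfl) (fun _ _ _ => rfl)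
    Data.size_int_sub_le hf hg

theorem mul (hf : PolyTimeInt s x f) (hg : PolyTimeInt s x g) :
    PolyTimeInt s x (fun p => f p * g p) :=
  binary .mul (fun y z => .int (y * z)) (fun _ _ _ => rfl) (fun _ _ _ => rfl)
    Data.size_int_mul_le hf hg

theorem div (hf : PolyTimeInt s x f) (hg : PolyTimeInt s x g) :
    PolyTimeInt s x (fun p => f p / g p) :=
  binary .div (fun y z => .int (y / z)) (fun _ _ _ => rfl) (fun _ _ _ => rfl)
    (fun y z => (Data.size_int_div_le y z).trans (Nat.le_add_right _ _)) hf hg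

theorem neg (hf : PolyTimeInt s x f) : PolyTimeInt s x (fun p => -f p) :=
  ((const 0).sub hf).congr (by simp)

theorem abs (hf : PolyTimeInt s x f) : PolyTimeInt s x (fun p => |f p|) := by
  have h : PolyTimeInt s x (fun p => if 0 ≤ f p then 1 else 0) :=
    (binary .le (fun y z => .ofProp (y ≤ z)) (fun _ _ _ => rfl) (fun _ _ _ => rfl)
      (fun y z => (Data.size_ofProp_le _).trans (by simp only [Data.size]; omega))
      (const 0) hf).congr fun p _ => by unfold Data.ofProp; split_ifs with h <;> simp [h]
  -- the sign is `2 * [0 ≤ f p] - 1`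
  refine (hf.mul ((h.mul (const 2)).sub (const 1))).congr fun p _ => ?_
  rcases le_or_gt 0 (f p) with h0 | h0
  · simp only [if_pos h0]; rw [abs_of_nonneg h0]; ring_nf
  · simp only [if_neg (not_le.mpr h0)]; rw [abs_of_neg h0]; ring_nf

end PolyTimeInt

/-! ### Loops, sums, products and lists -/

/-- The pairs of a parameter `p ∈ s` and an index below `N p`. -/
abbrev below {κ : Type*} (s : Set κ) (N : κ → ℕ) : Set (κ × ℕ) := {q | q.1 ∈ s ∧ q.2 < N q.1}

/-- The data `x`, enlarged by an index. -/
abbrev withIndex {κ : Type*} (x : κ → Data) : κ × ℕ → Data := fun q => .pair (x q.1) (.int q.2)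

/-- The natural numbers `N p` are computable in polynomial time and polynomially bounded in
value, so that they can serve as lengths of loops and as positions in lists. -/
structure PolyTimeIndex {κ : Type*} (s : Set κ) (x : κ → Data) (N : κ → ℕ) : Prop where
  computable : PolyTimeInt s x (fun p => N p)
  bounded : PolyBounded s x N

namespace PolyTimeOn

open Program

variable {κ κ' : Type*} {s : Set κ} {s' : Set κ'} {x y z : κ → Data} {x' : κ' → Data} {N : κ → ℕ}

/-- A while-loop that runs through polynomially many states of polynomially bounded size. The
first component of the state controls the loop. -/
theorem while_loop {S : κ → ℕ → Data} (h0 : PolyTimeOn s x (fun p => S p 0))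
    (hstep : PolyTimeOn (below s N) (fun q => S q.1 q.2) (fun q => S q.1 (q.2 + 1)))
    (hN : PolyBounded s x N)
    (hS : PolyBounded (below s (fun p => N p + 1)) (fun q => x q.1) (fun q => (S q.1 q.2).size))
    (hcont : ∀ p ∈ s, ∀ k < N p, (S p k).fst ≠ .int 0)
    (hexit : ∀ p ∈ s, (S p (N p)).fst = .int 0) : PolyTimeOn s x (fun p => S p (N p)) := by
  obtain ⟨c, b, P, H⟩ := h0
  obtain ⟨c', b', P', H'⟩ := hstep
  obtain ⟨Q, hQ⟩ := hN
  obtain ⟨R, hR⟩ := hS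
  have key : ∀ p ∈ s, ∀ m k, k + m = N p → ∀ σ : Store, σ 0 = S p k →
      ∃ τ t, (loop (.fst (.var 0)) c').Runs σ τ t ∧ τ 0 = S p (N p) ∧ (∀ v, b' < v → τ v = σ v) ∧
        t ≤ (m + 1) * (1 + 2 * R.eval (x p).size + P'.eval (R.eval (x p).size)) := by
    intro p hp m
    induction m with
    | zero =>
      intro k hk σ hσ
      obtain rfl : k = N p := by omega
      refine ⟨σ, _, .loop_false ?_, hσ, fun _ _ => rfl, ?_⟩
      · simpa [Expr.eval, hσ] using hexit p hp
      · have h1 := hR (p, N p) ⟨hp, by simp⟩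
        have h2 := (S p (N p)).size_fst_le
        simp only [Expr.cost, Expr.eval, hσ] at h1 h2 ⊢
        omega
    | succ m ih =>
      intro k hk σ hσ
      have hkN : k < N p := by omega
      obtain ⟨τ, t, h1, h2, h3, h4⟩ := H' (p, k) ⟨hp, hkN⟩ σ hσ
      obtain ⟨υ, r, h1', h2', h3', h4'⟩ := ih (k + 1) (by omega) τ h2
      refine ⟨υ, _, .loop_true ?_ h1 h1', h2', fun v hv => by rw [h3' v hv, h3 v hv], ?_⟩
      · simpa [Expr.eval, hσ] using hcont p hp k hkN
      · have h5 := hR (p, k) ⟨hp, by simp; omega⟩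
        have h6 := (S p k).size_fst_le
        have h7 := P'.eval_nat_mono h5
        simp only [Expr.cost, Expr.eval, hσ] at h4 h5 h6 h7 ⊢
        rw [Nat.add_mul (m + 1) 1, one_mul]
        omega
  refine ⟨.seq c (.loop (.fst (.var 0)) c'), max b b',
    1 + P + (Q + 1) * (1 + 2 * R + P'.comp R), fun p hp σ hσ => ?_⟩
  obtain ⟨τ, t, h1, h2, h3, h4⟩ := H p hp σ hσ
  obtain ⟨υ, r, h1', h2', h3', h4'⟩ := key p hp (N p) 0 (by omega) τ h2
  refine ⟨υ, _, h1.seq h1', h2', fun v hv => by rw [h3' v (by omega), h3 v (by omega)], ?_⟩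
  have h5 := h4'.trans (Nat.mul_le_mul_right _ (Nat.add_le_add_right (hQ p hp) 1))
  simp only [eval_add, eval_mul, eval_one, eval_comp, eval_ofNat]
  omega

/-- Computability is preserved under change of parameters, if the new data determine the old
ones. -/
theorem weaken (h : PolyTimeOn s x y) (g : κ' → κ) (hg : ∀ p ∈ s', g p ∈ s)
    (hx : PolyTimeOn s' x' (fun p => x (g p))) : PolyTimeOn s' x' (fun p => y (g p)) :=
  hx.trans (h.comp g hg)

/-- What is computable stays computable when an index is added to the data. -/
theorem lift (h : PolyTimeOn s x y) : PolyTimeOn (below s N) (withIndex x) (fun q => y q.1) :=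
  h.weaken Prod.fst (fun _ hq => hq.1) refl.fst

end PolyTimeOn

namespace PolyTimeIndex

variable {κ κ' : Type*} {s : Set κ} {s' : Set κ'} {x y z : κ → Data} {x' : κ' → Data} {M N : κ → ℕ}

theorem weaken (h : PolyTimeIndex s x N) (g : κ' → κ) (hg : ∀ p ∈ s', g p ∈ s)
    (hx : PolyTimeOn s' x' (fun p => x (g p))) : PolyTimeIndex s' x' (fun p => N (g p)) :=
  ⟨PolyTimeOn.weaken h.computable g hg hx, hx.size_le.trans (h.bounded.comp g hg)⟩

theorem lift (h : PolyTimeIndex s x N) : PolyTimeIndex (below s M) (withIndex x) (fun q => N q.1) :=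
  h.weaken Prod.fst (fun _ hq => hq.1) PolyTimeOn.refl.fst

theorem const (k : ℕ) : PolyTimeIndex s x (fun _ => k) :=
  ⟨PolyTimeInt.const k, PolyBounded.const k⟩

theorem add (hM : PolyTimeIndex s x M) (hN : PolyTimeIndex s x N) :
    PolyTimeIndex s x (fun p => M p + N p) :=
  ⟨(hM.computable.add hN.computable).congr fun p _ => by simp, hM.bounded.add hN.bounded⟩

theorem mul (hM : PolyTimeIndex s x M) (hN : PolyTimeIndex s x N) :
    PolyTimeIndex s x (fun p => M p * N p) :=
  ⟨(hM.computable.mul hN.computable).congr fun p _ => by simp, hM.bounded.mul hN.bounded⟩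

theorem sub (hM : PolyTimeIndex s x M) (hN : PolyTimeIndex s x N) (h : ∀ p ∈ s, N p ≤ M p) :
    PolyTimeIndex s x (fun p => M p - N p) :=
  ⟨(hM.computable.sub hN.computable).congr fun p hp => by simp [Nat.cast_sub (h p hp)],
    hM.bounded.mono fun p _ => Nat.sub_le _ _⟩

theorem of_le (hM : PolyTimeInt s x (fun p => M p)) (hN : PolyBounded s x N)
    (h : ∀ p ∈ s, M p ≤ N p) : PolyTimeIndex s x M :=
  ⟨hM, hN.mono h⟩

/-- The index that was added to the data last. -/
theorem last (hN : PolyTimeIndex s x N) : PolyTimeIndex (below s N) (withIndex x) Prod.snd :=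
  of_le PolyTimeOn.refl.snd hN.lift.bounded fun _ hq => hq.2.le

end PolyTimeIndex

theorem PolyBounded.withIndex {κ : Type*} {s : Set κ} {x : κ → Data} {N : κ → ℕ} {M : κ × ℕ → ℕ}
    (hM : PolyBounded (below s N) (withIndex x) M) (hN : PolyBounded s x N) :
    PolyBounded (below s N) (fun q => x q.1) M := by
  refine PolyBounded.trans (y := _root_.withIndex x) ?_ hM
  refine ((PolyBounded.size_self.add (hN.comp Prod.fst fun _ hq => hq.1)).add
    (PolyBounded.const 2)).mono fun q hq => ?_
  have h1 := Data.size_int_natCast_le q.2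
  have h2 := hq.2
  simp only [_root_.withIndex]
  rw [Data.size]
  omega

namespace PolyTimeOn

variable {κ : Type*} {s : Set κ} {x y z : κ → Data} {N : κ → ℕ}

/-- Primitive recursion of polynomial length, with intermediate results of polynomially bounded
size. -/
theorem iterate {F : κ → ℕ → Data} (hN : PolyTimeIndex s x N) (h0 : PolyTimeOn s x (fun p => F p 0))
    (hstep : PolyTimeOn (below s N) (fun q => .pair (withIndex x q) (F q.1 q.2))
      (fun q => F q.1 (q.2 + 1)))
    (hF : PolyBounded (below s (fun p => N p + 1)) (fun q => x q.1) (fun q => (F q.1 q.2).size)) :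
    PolyTimeOn s x (fun p => F p (N p)) := by
  -- a state consists of the number of remaining rounds, the input, the index, and the accumulator
  have main := while_loop (s := s) (x := x) (N := N)
    (S := fun p k => .pair (.int ((N p - k : ℕ) : ℤ)) (.pair (.pair (x p) (.int k)) (F p k)))
    ?_ ?_ hN.bounded ?_ ?_ ?_
  · exact main.snd.snd
  · exact (PolyTimeOn.pair hN.computable (.pair (.pair .refl (.const (.int 0))) h0)).congr
      fun p _ => by simp
  · have hx : PolyTimeOn (below s N)
        (fun q => .pair (.int ((N q.1 - q.2 : ℕ) : ℤ)) (.pair (withIndex x q) (F q.1 q.2)))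
        (fun q => .pair (withIndex x q) (F q.1 q.2)) := refl.snd
    have h1 : PolyTimeInt (below s N)
        (fun q => .pair (.int ((N q.1 - q.2 : ℕ) : ℤ)) (.pair (withIndex x q) (F q.1 q.2)))
        (fun q => ((N q.1 - q.2 : ℕ) : ℤ)) := refl.fst
    have h2 : PolyTimeInt (below s N)
        (fun q => .pair (.int ((N q.1 - q.2 : ℕ) : ℤ)) (.pair (withIndex x q) (F q.1 q.2)))
        (fun q => (q.2 : ℤ)) := hx.fst.snd
    refine ((h1.sub (.const 1)).pair ((hx.fst.fst.pair (h2.add (.const 1))).pair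
      (hx.trans hstep))).congr fun q hq => ?_
    have := hq.2
    congr 2
    dsimp only
    omega
  · have hx : PolyBounded (below s (fun p => N p + 1)) (fun q => x q.1) (fun q => N q.1) :=
      hN.bounded.comp Prod.fst fun _ hq => hq.1
    refine (((hF.add PolyBounded.size_self).add (hx.mul (PolyBounded.const 2))).add
      (PolyBounded.const 5)).mono fun q hq => ?_
    have h1 := Data.size_int_natCast_le q.2
    have h2 := Data.size_int_natCast_le (N q.1 - q.2)
    have h3 : q.2 < N q.1 + 1 := hq.2
    rw [Data.size.eq_2, Data.size.eq_2, Data.size.eq_2]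
    omega
  · intro p _ k hk h
    simp only [Data.fst, Data.int.injEq] at h
    omega
  · intro p _
    simp [Data.fst]

end PolyTimeOn

namespace PolyTimeInt

variable {κ : Type*} {s : Set κ} {x : κ → Data} {N : κ → ℕ} {f : κ → ℕ → ℤ}

theorem sum (hN : PolyTimeIndex s x N)
    (hf : PolyTimeInt (below s N) (withIndex x) (fun q => f q.1 q.2)) :
    PolyTimeInt s x (fun p => ∑ j ∈ Finset.range (N p), f p j) := by
  obtain ⟨R, hR⟩ := (PolyTimeOn.size_le hf).withIndex hN.bounded
  refine PolyTimeOn.iterate (F := fun p k => .int (∑ j ∈ Finset.range k, f p j)) hN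
    (PolyTimeOn.const (.int 0)) ?_ ?_
  · have h1 : PolyTimeInt (below s N)
        (fun q => .pair (withIndex x q) (.int (∑ j ∈ Finset.range q.2, f q.1 j)))
        (fun q => ∑ j ∈ Finset.range q.2, f q.1 j) := PolyTimeOn.refl.snd
    exact (h1.add (PolyTimeOn.refl.fst.trans hf)).congr fun q _ => by rw [Finset.sum_range_succ]
  · have hx : PolyBounded (below s (fun p => N p + 1)) (fun q => x q.1) (fun q => N q.1) :=
      hN.bounded.comp Prod.fst fun _ hq => hq.1
    refine ((PolyBounded.size_self.eval R).mul hx).add (PolyBounded.const 1) |>.mono fun q hq => ?_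
    have key : ∀ k ≤ N q.1, (Data.int (∑ j ∈ Finset.range k, f q.1 j)).size ≤
        R.eval (x q.1).size * k + 1 := by
      intro k
      induction k with
      | zero => simp [Data.size]
      | succ k ih =>
        intro hk
        have h1 := ih (by omega)
        have h2 := Data.size_int_add_le (∑ j ∈ Finset.range k, f q.1 j) (f q.1 k)
        have h3 := hR (q.1, k) ⟨hq.1, hk⟩
        rw [Finset.sum_range_succ, mul_add]
        dsimp only at h3
        omega
    exact (key q.2 (Nat.lt_succ_iff.mp hq.2)).trans
      (Nat.add_le_add_right (Nat.mul_le_mul_left _ (Nat.lt_succ_iff.mp hq.2)) 1)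

theorem prod (hN : PolyTimeIndex s x N)
    (hf : PolyTimeInt (below s N) (withIndex x) (fun q => f q.1 q.2)) :
    PolyTimeInt s x (fun p => ∏ j ∈ Finset.range (N p), f p j) := by
  obtain ⟨R, hR⟩ := (PolyTimeOn.size_le hf).withIndex hN.bounded
  refine PolyTimeOn.iterate (F := fun p k => .int (∏ j ∈ Finset.range k, f p j)) hN
    (PolyTimeOn.const (.int 1)) ?_ ?_
  · have h1 : PolyTimeInt (below s N)
        (fun q => .pair (withIndex x q) (.int (∏ j ∈ Finset.range q.2, f q.1 j)))
        (fun q => ∏ j ∈ Finset.range q.2, f q.1 j) := PolyTimeOn.refl.snd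
    exact (h1.mul (PolyTimeOn.refl.fst.trans hf)).congr fun q _ => by rw [Finset.prod_range_succ]
  · have hx : PolyBounded (below s (fun p => N p + 1)) (fun q => x q.1) (fun q => N q.1) :=
      hN.bounded.comp Prod.fst fun _ hq => hq.1
    refine ((PolyBounded.size_self.eval R).mul hx).add (PolyBounded.const 2) |>.mono fun q hq => ?_
    have key : ∀ k ≤ N q.1, (Data.int (∏ j ∈ Finset.range k, f q.1 j)).size ≤
        R.eval (x q.1).size * k + 2 := by
      intro k
      induction k with
      | zero => simp [Data.size]
      | succ k ih =>
        intro hk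
        have h1 := ih (by omega)
        have h2 := Data.size_int_mul_le (∏ j ∈ Finset.range k, f q.1 j) (f q.1 k)
        have h3 := hR (q.1, k) ⟨hq.1, hk⟩
        rw [Finset.prod_range_succ, mul_add]
        dsimp only at h3
        omega
    exact (key q.2 (Nat.lt_succ_iff.mp hq.2)).trans
      (Nat.add_le_add_right (Nat.mul_le_mul_left _ (Nat.lt_succ_iff.mp hq.2)) 2)

theorem pow {g : κ → ℤ} (hg : PolyTimeInt s x g) (hN : PolyTimeIndex s x N) :
    PolyTimeInt s x (fun p => g p ^ N p) :=
  (prod (f := fun p _ => g p) hN hg.lift).congr fun p _ => by simp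

theorem factorial (hN : PolyTimeIndex s x N) : PolyTimeInt s x (fun p => ((N p).factorial : ℤ)) :=
  (prod (f := fun _ j => ((j + 1 : ℕ) : ℤ)) hN (hN.last.add (.const 1)).computable).congr
    fun p _ => by simp [← Finset.prod_range_add_one_eq_factorial]

end PolyTimeInt

namespace Data

theorem snd_iterate_ofList (l : List Data) (k : ℕ) : snd^[k] (ofList l) = ofList (l.drop k) := by
  induction k generalizing l with
  | zero => simp
  | succ k ih =>
    rw [Function.iterate_succ_apply]
    cases l with
    | nil => exact (ih []).trans (by simp)
    | cons a l => exact ih l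

theorem size_ofList_drop_le (l : List Data) (k : ℕ) : (ofList (l.drop k)).size ≤
    (ofList l).size := by
  induction k generalizing l with
  | zero => simp
  | succ k ih =>
    cases l with
    | nil => simp
    | cons a l => have := ih l; simp only [List.drop_succ_cons, ofList, size]; omega

theorem size_ofList_le (l : List Data) {B : ℕ} (h : ∀ a ∈ l, a.size ≤ B) :
    (ofList l).size ≤ 1 + l.length * (1 + B) := by
  induction l with
  | nil => simp [ofList, nil, size]
  | cons a l ih =>
    have h1 := h a (by simp)
    have h2 := ih fun b hb => h b (by simp [hb])
    simp only [ofList, size, List.length_cons, add_mul, one_mul] at *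
    omega

theorem length_le_size_ofList (l : List Data) : l.length ≤ (ofList l).size := by
  induction l with
  | nil => simp
  | cons a l ih => simp only [ofList, size, List.length_cons]; omega

end Data

namespace PolyTimeOn

variable {κ : Type*} {s : Set κ} {x y : κ → Data} {l : κ → List Data} {j N : κ → ℕ}

theorem getElem (hl : PolyTimeOn s x (fun p => .ofList (l p))) (hj : PolyTimeIndex s x j)
    (h : ∀ p ∈ s, (l p)[j p]? = some (y p)) : PolyTimeOn s x y := by
  have main : PolyTimeOn s x (fun p => .ofList ((l p).drop (j p))) := by
    refine iterate (F := fun p k => .ofList ((l p).drop k)) hj (by simpa using hl) ?_ ?_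
    · have h1 : PolyTimeOn (below s j) (fun q => .pair (withIndex x q) (.ofList ((l q.1).drop q.2)))
        (fun q => .ofList ((l q.1).drop q.2)) := refl.snd
      refine h1.snd.congr fun q _ => ?_
      rw [← Data.snd_iterate_ofList, ← Data.snd_iterate_ofList, Function.iterate_succ_apply']
    · exact (hl.size_le.comp Prod.fst fun q hq => hq.1).mono fun q _ => Data.size_ofList_drop_le _ _
  refine main.fst.congr fun p hp => ?_
  obtain ⟨h1, h2⟩ := List.getElem?_eq_some_iff.mp (h p hp)
  rw [List.drop_eq_getElem_cons h1, h2]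
  rfl

theorem length (hl : PolyTimeOn s x (fun p => .ofList (l p))) :
    PolyTimeIndex s x (fun p => (l p).length) := by
  have hb : PolyBounded s x (fun p => (l p).length) :=
    hl.size_le.mono fun p _ => Data.length_le_size_ofList _
  refine ⟨?_, hb⟩
  -- the remaining list controls the loop: it is the integer `0` exactly when it is empty
  have main := while_loop (s := s) (x := x) (N := fun p => (l p).length)
    (S := fun p k => .pair (.ofList ((l p).drop k)) (.int k)) ?_ ?_ hb ?_ ?_ ?_
  · exact main.snd
  · simpa using hl.pair (const (.int 0))
  · have h1 : PolyTimeInt (below s fun p => (l p).length)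
      (fun q => .pair (.ofList ((l q.1).drop q.2)) (.int q.2)) (fun q => (q.2 : ℤ)) := refl.snd
    refine (refl.fst.snd.pair (h1.add (.const 1))).congr fun q hq => ?_
    rw [List.drop_eq_getElem_cons hq.2]
    rfl
  · refine (((hl.size_le.add hb).add (PolyBounded.const 2)).comp Prod.fst
      fun q hq => hq.1).mono fun q hq => ?_
    have h1 := Data.size_ofList_drop_le (l q.1) q.2
    have h2 := Data.size_int_natCast_le q.2
    have h3 : q.2 < (l q.1).length + 1 := hq.2
    rw [Data.size]
    omega
  · intro p _ k hk
    rw [List.drop_eq_getElem_cons hk]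
    exact Data.noConfusion
  · intro p _
    simp [Data.ofList, Data.fst, Data.nil]

theorem tabulate {f : κ → ℕ → Data} (hN : PolyTimeIndex s x N)
    (hf : PolyTimeOn (below s N) (withIndex x) (fun q => f q.1 q.2)) :
    PolyTimeOn s x (fun p => .ofList (.ofFn fun i : Fin (N p) => f p i)) := by
  obtain ⟨R, hR⟩ := hf.size_le.withIndex hN.bounded
  -- the list is built from its end
  refine (iterate (F := fun p k => .ofList ((List.ofFn fun i : Fin (N p) => f p i).drop (N p - k)))
    hN ?_ ?_ ?_).congr fun p _ => by simp
  · refine (const .nil).congr fun p _ => ?_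
    rw [List.drop_of_length_le (by simp)]
    rfl
  · have hx : PolyTimeOn (below s N) (fun q => .pair (withIndex x q)
        (.ofList ((List.ofFn fun i : Fin (N q.1) => f q.1 i).drop (N q.1 - q.2)))) (withIndex x) :=
      refl.fst
    have h1 : PolyTimeIndex (below s N) (withIndex x) (fun q => N q.1 - q.2 - 1) :=
      ((hN.lift.sub hN.last fun q hq => hq.2.le).sub (.const 1) fun q hq => by
        have := hq.2; omega)
    have h2 : PolyTimeOn (below s N) (withIndex x) (fun q => f q.1 (N q.1 - q.2 - 1)) :=
      hf.weaken (fun q : κ × ℕ => (q.1, N q.1 - q.2 - 1))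
        (fun q (hq : q ∈ below s N) => ⟨hq.1, by have := hq.2; dsimp only; omega⟩)
            (refl.fst.pair h1.computable)
    refine ((hx.trans h2).pair refl.snd).congr fun q hq => ?_
    have hq2 := hq.2
    rw [List.drop_eq_getElem_cons (i := N q.1 - (q.2 + 1)) (by simp; omega)]
    have h3 : N q.1 - (q.2 + 1) = N q.1 - q.2 - 1 := by omega
    have h4 : N q.1 - q.2 - 1 + 1 = N q.1 - q.2 := by omega
    simp only [List.getElem_ofFn, Data.ofList, h3, h4]
    rfl
  · refine (((hN.bounded.comp Prod.fst fun q hq => hq.1).mul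
      ((PolyBounded.const 1).add (PolyBounded.size_self.eval R))).add (PolyBounded.const 1)).mono
      fun q hq => (Data.size_ofList_drop_le _ _).trans ?_
    refine (Data.size_ofList_le _ (B := R.eval (x q.1).size) fun a ha => ?_).trans ?_
    · obtain ⟨i, rfl⟩ := List.mem_ofFn.mp ha
      exact hR (q.1, i) ⟨hq.1, i.2⟩
    · simp only [List.length_ofFn]; omega

end PolyTimeOn

/-! ### The quantities computed by the algorithm -/

/-- A cubical array of rational numbers, of any side length. The quantities below are defined, and
computable in polynomial time, for every such array; what is said about their meaning refers to the
case that the entries are the structure constants of an algebra. -/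
structure RatArray where
  n : ℕ
  entry : Fin n → Fin n → Fin n → ℚ

/-- The coefficients `1 = c 0, c 1, c 2, …` obtained by Newton's identities from `p j`, the sum
of the `(j + 1)`-st powers of the roots. The division is exact if `p` really consists of power
sums of the roots of an integer polynomial. -/
def newtonCoeff (p : ℕ → ℤ) : ℕ → ℤ
  | 0 => 1
  | k + 1 => -(∑ t : Fin (k + 1), newtonCoeff p (k - t) * p t) / ((k + 1 : ℕ) : ℤ)
termination_by k => k

theorem newtonCoeff_zero (p : ℕ → ℤ) : newtonCoeff p 0 = 1 := by rw [newtonCoeff]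

theorem newtonCoeff_succ (p : ℕ → ℤ) (k : ℕ) : newtonCoeff p (k + 1) =
    -(∑ t ∈ Finset.range (k + 1), newtonCoeff p (k - t) * p t) / ((k + 1 : ℕ) : ℤ) := by
  rw [newtonCoeff, Finset.sum_range]

/-- The bound holds whether or not the divisions are exact. -/
theorem abs_newtonCoeff_le {p : ℕ → ℤ} {B : ℤ} {k : ℕ} (hp : ∀ t < k, |p t| ≤ B) :
    |newtonCoeff p k| ≤ (1 + B) ^ k := by
  induction k using Nat.strong_induction_on with
  | _ k ih =>
    cases k with
    | zero => simp [newtonCoeff_zero]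
    | succ k =>
      have hB : 0 ≤ B := (abs_nonneg _).trans (hp 0 (Nat.succ_pos k))
      rw [newtonCoeff_succ]
      have h1 : ∀ y z : ℤ, |-y / z| ≤ |y| := fun y z => by
        have := Int.natAbs_ediv_le_natAbs (-y) z
        rw [Int.abs_eq_natAbs, Int.abs_eq_natAbs]
        omega
      calc _ ≤ _ := h1 _ _
        _ ≤ ∑ t ∈ Finset.range (k + 1), |newtonCoeff p (k - t) * p t| :=
          Finset.abs_sum_le_sum_abs _ _
        _ ≤ ∑ t ∈ Finset.range (k + 1), (1 + B) ^ (k + 1 - 1 - t) * B := by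
          refine Finset.sum_le_sum fun t ht => ?_
          have ht' := Finset.mem_range.mp ht
          rw [abs_mul]
          exact mul_le_mul (ih (k - t) (by omega) fun r hr => hp r (by omega)) (hp t ht')
            (abs_nonneg _) (by positivity)
        _ = (1 + B) ^ (k + 1) - 1 := by
          rw [Finset.sum_range_reflect (fun t => (1 + B) ^ t * B) (k + 1), ← Finset.sum_mul]
          simpa using geom_sum_mul (1 + B) (k + 1)
        _ ≤ _ := by omega

namespace RatArray

variable (a : RatArray)

/-- The entries, extended by zero to all triples of natural numbers. -/
def coeff (i j l : ℕ) : ℚ :=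
  if h : i < a.n ∧ j < a.n ∧ l < a.n then a.entry ⟨i, h.1⟩ ⟨j, h.2.1⟩ ⟨l, h.2.2⟩ else 0

/-- A common denominator of the entries: the product of all denominators. -/
def den : ℤ := ∏ i ∈ Finset.range a.n, ∏ j ∈ Finset.range a.n, ∏ l ∈ Finset.range a.n,
  ((a.coeff i j l).den : ℤ)

/-- The entries multiplied by the common denominator: the structure constants on the basis
that is multiplied by it. -/
def intCoeff (i j l : ℕ) : ℤ := (a.coeff i j l).num * (a.den / ((a.coeff i j l).den : ℤ))

/-- The sum of the absolute values of the scaled entries. It bounds the values of the scaled basis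
elements under all homomorphisms to `ℂ`. -/
def bound : ℤ := ∑ i ∈ Finset.range a.n, ∑ j ∈ Finset.range a.n, ∑ l ∈ Finset.range a.n,
  |a.intCoeff i j l|

/-- The integer `κ` for which `β = ∑ i, κ ^ i • f i`, with `f` the scaled basis, separates the
homomorphisms to `ℂ`. -/
def radix : ℤ := 2 * a.bound + 1

/-- Multiplication by `β` on the scaled basis: `β * f s = ∑ l, mulCoeff s l • f l`. -/
def mulCoeff (s l : ℕ) : ℤ := ∑ i ∈ Finset.range a.n, a.radix ^ i * a.intCoeff i s l

/-- The coordinates of the powers of `β`: `β ^ (j + 1) = ∑ l, powCoord j l • f l`. -/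
def powCoord : ℕ → ℕ → ℤ
  | 0, l => a.radix ^ l
  | j + 1, l => ∑ s ∈ Finset.range a.n, powCoord j s * a.mulCoeff s l

/-- The trace of `β ^ (j + 1)`. -/
def tracePow (j : ℕ) : ℤ :=
  ∑ l ∈ Finset.range a.n, a.powCoord j l * ∑ s ∈ Finset.range a.n, a.intCoeff l s s

/-- The coefficient of `X ^ (n - t)` in the characteristic polynomial of `β`. -/
def charCoeff (t : ℕ) : ℤ := newtonCoeff a.tracePow t

/-- A bound for the roots of the characteristic polynomial of `β`. -/
def rootBound : ℤ := ∑ t ∈ Finset.range (a.n + 1), |a.charCoeff t|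

/-- A number that clears the denominators of antiderivatives. -/
def denInt : ℤ := ((2 * a.n + 1).factorial : ℤ)

/-- The integer used as a radix to combine the antiderivatives of `χ * X ^ m`, for `m ≤ n`,
with `χ` the characteristic polynomial of `β`. -/
def outputRadix : ℤ := 2 * (a.denInt * a.rootBound ^ (2 * a.n + 2)) + 1

/-- The coefficient of `X ^ (n - t + m + 1)` in `denInt` times the antiderivative of
`χ * X ^ m`. -/
def antiCoeff (m t : ℕ) : ℤ := a.charCoeff t * (a.denInt / ((a.n - t + m + 1 : ℕ) : ℤ))

/-- The coordinates, on the given basis, of a primitive element of the separable subalgebra. -/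
def primitiveCoord (l : ℕ) : ℤ := a.den * ∑ m ∈ Finset.range (a.n + 1), a.outputRadix ^ m *
  ∑ t ∈ Finset.range (a.n + 1), a.antiCoeff m t * a.powCoord (a.n - t + m) l

/-- The coordinates of `β ^ (j + 1)` grow at most geometrically with `j`. -/
theorem sum_abs_powCoord_le (j : ℕ) : ∑ l ∈ Finset.range a.n, |a.powCoord j l| ≤
    (∑ l ∈ Finset.range a.n, |a.radix ^ l|) *
      (∑ s ∈ Finset.range a.n, ∑ l ∈ Finset.range a.n, |a.mulCoeff s l|) ^ j := by
  induction j with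
  | zero => simp [powCoord]
  | succ j ih =>
    rw [pow_succ, ← mul_assoc]
    refine le_trans ?_ (mul_le_mul_of_nonneg_right ih (by positivity))
    calc _ ≤ ∑ l ∈ Finset.range a.n, ∑ s ∈ Finset.range a.n, |a.powCoord j s| * |a.mulCoeff s l| :=
          Finset.sum_le_sum fun l _ => by
            simp only [powCoord, ← abs_mul]
            exact Finset.abs_sum_le_sum_abs _ _
      _ = ∑ s ∈ Finset.range a.n, |a.powCoord j s| * ∑ l ∈ Finset.range a.n, |a.mulCoeff s l| := by
          rw [Finset.sum_comm]
          simp only [Finset.mul_sum]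
      _ ≤ _ := by
          rw [Finset.sum_mul]
          refine Finset.sum_le_sum fun s hs => mul_le_mul_of_nonneg_left ?_ (abs_nonneg _)
          exact Finset.single_le_sum (f := fun s => ∑ l ∈ Finset.range a.n, |a.mulCoeff s l|)
            (fun _ _ => by positivity) hs

/-! ### The algorithm runs in polynomial time -/

section PolyTime

variable {κ : Type*} {s : Set κ} {x : κ → Data} {a : κ → RatArray} {i j l m t : κ → ℕ}

theorem polyTime_n (ha : PolyTimeOn s x fun p => .ofArray (a p).entry) :
    PolyTimeIndex s x fun p => (a p).n := by
  simpa using PolyTimeOn.length ha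

theorem polyTime_coeff (ha : PolyTimeOn s x fun p => .ofArray (a p).entry)
    (hi : PolyTimeIndex s x i) (hj : PolyTimeIndex s x j) (hl : PolyTimeIndex s x l)
    (hin : ∀ p ∈ s, i p < (a p).n) (hjn : ∀ p ∈ s, j p < (a p).n) (hln : ∀ p ∈ s, l p < (a p).n) :
    PolyTimeOn s x fun p => .ofRat ((a p).coeff (i p) (j p) (l p)) := by
  have h1 : PolyTimeOn s x fun p => .ofList (.ofFn fun j' : Fin (a p).n =>
      .ofVec fun l' : Fin (a p).n => (a p).coeff (i p) j' l') := by
    refine ha.getElem hi fun p hp => ?_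
    simp [coeff, hin p hp]
  have h2 : PolyTimeOn s x fun p => .ofVec fun l' : Fin (a p).n => (a p).coeff (i p) (j p) l' := by
    refine h1.getElem hj fun p hp => ?_
    simp [hjn p hp]
  refine PolyTimeOn.getElem h2 hl fun p hp => ?_
  simp [hln p hp]

theorem polyTime_den (ha : PolyTimeOn s x fun p => .ofArray (a p).entry) :
    PolyTimeInt s x fun p => (a p).den := by
  have hn := polyTime_n ha
  refine .prod hn <| .prod hn.lift <| .prod hn.lift.lift ?_
  exact (polyTime_coeff ha.lift.lift.lift hn.last.lift.lift hn.lift.last.lift hn.lift.lift.last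
    (fun q hq => hq.1.1.2) (fun q hq => hq.1.2) (fun q hq => hq.2)).snd

theorem polyTime_intCoeff (ha : PolyTimeOn s x fun p => .ofArray (a p).entry)
    (hi : PolyTimeIndex s x i) (hj : PolyTimeIndex s x j) (hl : PolyTimeIndex s x l)
    (hin : ∀ p ∈ s, i p < (a p).n) (hjn : ∀ p ∈ s, j p < (a p).n) (hln : ∀ p ∈ s, l p < (a p).n) :
    PolyTimeInt s x fun p => (a p).intCoeff (i p) (j p) (l p) :=
  have h := polyTime_coeff ha hi hj hl hin hjn hln
  .mul h.fst (.div (polyTime_den ha) h.snd)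

theorem polyTime_bound (ha : PolyTimeOn s x fun p => .ofArray (a p).entry) :
    PolyTimeInt s x fun p => (a p).bound := by
  have hn := polyTime_n ha
  refine .sum hn <| .sum hn.lift <| .sum hn.lift.lift <| .abs ?_
  exact polyTime_intCoeff ha.lift.lift.lift hn.last.lift.lift hn.lift.last.lift hn.lift.lift.last
    (fun q hq => hq.1.1.2) (fun q hq => hq.1.2) (fun q hq => hq.2)

theorem polyTime_radix (ha : PolyTimeOn s x fun p => .ofArray (a p).entry) :
    PolyTimeInt s x fun p => (a p).radix :=
  .add (.mul (.const 2) (polyTime_bound ha)) (.const 1)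

theorem polyTime_mulCoeff (ha : PolyTimeOn s x fun p => .ofArray (a p).entry)
    (hj : PolyTimeIndex s x j) (hl : PolyTimeIndex s x l)
    (hjn : ∀ p ∈ s, j p < (a p).n) (hln : ∀ p ∈ s, l p < (a p).n) :
    PolyTimeInt s x fun p => (a p).mulCoeff (j p) (l p) := by
  have hn := polyTime_n ha
  refine .sum hn <| .mul (.pow (polyTime_radix ha.lift) hn.last) ?_
  exact polyTime_intCoeff ha.lift hn.last hj.lift hl.lift (fun q hq => hq.2)
    (fun q hq => hjn _ hq.1) (fun q hq => hln _ hq.1)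

theorem polyTime_powCoord (ha : PolyTimeOn s x fun p => .ofArray (a p).entry)
    (hj : PolyTimeIndex s x j) (hl : PolyTimeIndex s x l) (hln : ∀ p ∈ s, l p < (a p).n) :
    PolyTimeInt s x fun p => (a p).powCoord (j p) (l p) := by
  have hn := polyTime_n ha
  suffices h : PolyTimeOn s x fun p =>
      .ofList (.ofFn fun l' : Fin (a p).n => .int ((a p).powCoord (j p) l')) by
    refine h.getElem hl fun p hp => ?_
    simp [hln p hp]
  refine PolyTimeOn.iterate (F := fun p k =>
    .ofList (.ofFn fun l' : Fin (a p).n => .int ((a p).powCoord k l'))) hj ?_ ?_ ?_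
  · exact PolyTimeOn.tabulate hn (f := fun p l' => .int ((a p).radix ^ l'))
      (PolyTimeInt.pow (polyTime_radix ha).lift hn.last)
  · have hx : PolyTimeOn (below s j) (fun q => .pair (withIndex x q)
        (.ofList (.ofFn fun l' : Fin (a q.1).n => .int ((a q.1).powCoord q.2 l')))) (withIndex x) :=
      .fst .refl
    have hn' := hn.lift.weaken id (fun _ hq => hq) hx
    have ha' := hx.trans ha.lift
    refine PolyTimeOn.tabulate hn' (f := fun q l' => .int ((a q.1).powCoord (q.2 + 1) l')) <|
      PolyTimeInt.sum hn'.lift <| .mul ?_ ?_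
    · refine PolyTimeOn.getElem (l := fun q => .ofFn fun l' : Fin (a q.1.1.1).n =>
        .int ((a q.1.1.1).powCoord q.1.1.2 l')) (PolyTimeOn.snd .refl).lift.lift hn'.lift.last
        fun q hq => ?_
      simp [hq.2]
    · exact polyTime_mulCoeff ha'.lift.lift hn'.lift.last hn'.last.lift (fun q hq => hq.2)
        fun q hq => hq.1.2
  · have hj1 := hj.add (.const 1)
    have h1 : PolyTimeInt s x fun p => ∑ l ∈ Finset.range (a p).n, |(a p).radix ^ l| :=
      .sum hn (.abs (.pow (polyTime_radix ha).lift hn.last))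
    have h2 : PolyTimeInt s x fun p =>
        ∑ r ∈ Finset.range (a p).n, ∑ l ∈ Finset.range (a p).n, |(a p).mulCoeff r l| :=
      .sum hn <| .sum hn.lift <| .abs <| polyTime_mulCoeff ha.lift.lift hn.last.lift
        hn.lift.last (fun q hq => hq.1.2) fun q hq => hq.2
    have h3 : PolyTimeInt (below s fun p => j p + 1) (withIndex x) fun q =>
        (∑ l ∈ Finset.range (a q.1).n, |(a q.1).radix ^ l|) *
        (∑ r ∈ Finset.range (a q.1).n, ∑ l ∈ Finset.range (a q.1).n,
            |(a q.1).mulCoeff r l|) ^ q.2 :=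
      .mul (PolyTimeOn.lift h1) (.pow (PolyTimeOn.lift h2) hj1.last)
    obtain ⟨R, hR⟩ := (PolyTimeOn.size_le h3).withIndex hj1.bounded
    refine (((hn.bounded.comp Prod.fst fun q hq => hq.1).mul
      ((PolyBounded.const 1).add (PolyBounded.size_self.eval R))).add (PolyBounded.const 1)).mono
      fun q hq => ?_
    refine (Data.size_ofList_le _ (B := R.eval (x q.1).size) fun d hd => ?_).trans ?_
    · obtain ⟨l', rfl⟩ := List.mem_ofFn.mp hd
      refine le_trans (Data.size_int_le_of_abs_le ?_) (hR q hq)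
      exact (Finset.single_le_sum (f := fun l => |(a q.1).powCoord q.2 l|)
        (fun _ _ => abs_nonneg _) (Finset.mem_range.mpr l'.2)).trans
        ((a q.1).sum_abs_powCoord_le q.2)
    · simp only [List.length_ofFn]; omega

theorem polyTime_tracePow (ha : PolyTimeOn s x fun p => .ofArray (a p).entry)
    (hj : PolyTimeIndex s x j) : PolyTimeInt s x fun p => (a p).tracePow (j p) := by
  have hn := polyTime_n ha
  refine .sum hn <| .mul (polyTime_powCoord ha.lift hj.lift hn.last fun q hq => hq.2) <|
    .sum hn.lift ?_
  exact polyTime_intCoeff ha.lift.lift hn.last.lift hn.lift.last hn.lift.last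
    (fun q hq => hq.1.2) (fun q hq => hq.2) (fun q hq => hq.2)

/-- The recursion is on the list of all coefficients found so far, the last one first. -/
theorem polyTime_charCoeff (ha : PolyTimeOn s x fun p => .ofArray (a p).entry)
    (ht : PolyTimeIndex s x t) : PolyTimeInt s x fun p => (a p).charCoeff (t p) := by
  suffices h : PolyTimeOn s x fun p =>
      .ofList ((List.range (t p + 1)).map fun r => .int ((a p).charCoeff (t p - r))) from
    h.getElem (.const 0) fun p hp => by simp
  refine PolyTimeOn.iterate (F := fun p k =>
    .ofList ((List.range (k + 1)).map fun r => .int ((a p).charCoeff (k - r)))) ht ?_ ?_ ?_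
  · exact (PolyTimeOn.const (.pair (.int 1) .nil)).congr fun p _ => by
      simp [charCoeff, newtonCoeff_zero, Data.ofList]
  · have hx : PolyTimeOn (below s t) (fun q => .pair (withIndex x q) (.ofList
        ((List.range (q.2 + 1)).map fun r => .int ((a q.1).charCoeff (q.2 - r))))) (withIndex x) :=
      .fst .refl
    have ha' := hx.trans ha.lift
    have hk := (ht.last.add (.const 1)).weaken id (fun _ hq => hq) hx
    have hsum : PolyTimeInt (below s t) (fun q => .pair (withIndex x q) (.ofList
        ((List.range (q.2 + 1)).map fun r => .int ((a q.1).charCoeff (q.2 - r)))))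
        (fun q => ∑ r ∈ Finset.range (q.2 + 1),
          (a q.1).charCoeff (q.2 - r) * (a q.1).tracePow r) := by
      refine .sum hk <| .mul ?_ (polyTime_tracePow ha'.lift hk.last)
      refine PolyTimeOn.getElem (l := fun q => (List.range (q.1.2 + 1)).map fun r =>
        .int ((a q.1.1).charCoeff (q.1.2 - r))) (PolyTimeOn.snd .refl).lift hk.last fun q hq => ?_
      have hq2 := hq.2
      simp [hq2]
    refine (PolyTimeOn.pair (PolyTimeInt.div hsum.neg hk.computable) (.snd .refl)).congr
      fun q _ => ?_
    rw [List.range_succ_eq_map (n := q.2 + 1)]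
    simp only [List.map_cons, List.map_map, Data.ofList, Data.snd, charCoeff, Nat.sub_zero,
      newtonCoeff_succ, Function.comp_def, Nat.succ_eq_add_one, Nat.add_sub_add_right]
    rfl
  · have ht1 := ht.add (.const 1)
    have hs : PolyTimeInt s x fun p => ∑ r ∈ Finset.range (t p), |(a p).tracePow r| :=
      .sum ht (.abs (polyTime_tracePow ha.lift ht.last))
    have hs' : PolyTimeInt (below s fun p => t p + 1) (withIndex x) fun q =>
        (1 + ∑ r ∈ Finset.range (t q.1), |(a q.1).tracePow r|) ^ q.2 :=
      .pow (.add (.const 1) (PolyTimeOn.lift hs)) ht1.last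
    obtain ⟨R, hR⟩ := (PolyTimeOn.size_le hs').withIndex ht1.bounded
    have key : ∀ p ∈ s, ∀ k ≤ t p, (Data.int ((a p).charCoeff k)).size ≤ R.eval (x p).size := by
      intro p hp k hk
      refine le_trans (Data.size_int_le_of_abs_le ?_) (hR (p, k) ⟨hp, Nat.lt_succ_of_le hk⟩)
      exact abs_newtonCoeff_le fun r hr => Finset.single_le_sum (f := fun r => |(a p).tracePow r|)
        (fun _ _ => abs_nonneg _) (Finset.mem_range.mpr (hr.trans_le hk))
    refine (((ht1.bounded.comp Prod.fst fun q hq => hq.1).mul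
      ((PolyBounded.const 1).add (PolyBounded.size_self.eval R))).add (PolyBounded.const 1)).mono
      fun q hq => ?_
    have hq2 : q.2 < t q.1 + 1 := hq.2
    refine (Data.size_ofList_le _ (B := R.eval (x q.1).size) fun d hd => ?_).trans ?_
    · obtain ⟨r, hr, rfl⟩ := List.mem_map.mp hd
      exact key q.1 hq.1 _ (by omega)
    · rw [List.length_map, List.length_range, add_comm]
      exact Nat.add_le_add_right (Nat.mul_le_mul_right _ hq2) 1

theorem polyTime_rootBound (ha : PolyTimeOn s x fun p => .ofArray (a p).entry) :
    PolyTimeInt s x fun p => (a p).rootBound :=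
  have hn := (polyTime_n ha).add (.const 1)
  .sum hn (.abs (polyTime_charCoeff ha.lift hn.last))

theorem polyTime_denInt (ha : PolyTimeOn s x fun p => .ofArray (a p).entry) :
    PolyTimeInt s x fun p => (a p).denInt :=
  .factorial (((PolyTimeIndex.const 2).mul (polyTime_n ha)).add (.const 1))

theorem polyTime_outputRadix (ha : PolyTimeOn s x fun p => .ofArray (a p).entry) :
    PolyTimeInt s x fun p => (a p).outputRadix :=
  .add (.mul (.const 2) (.mul (polyTime_denInt ha) (.pow (polyTime_rootBound ha)
    (((PolyTimeIndex.const 2).mul (polyTime_n ha)).add (.const 2))))) (.const 1)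

theorem polyTime_primitiveCoord (ha : PolyTimeOn s x fun p => .ofArray (a p).entry)
    (hl : PolyTimeIndex s x l) (hln : ∀ p ∈ s, l p < (a p).n) :
    PolyTimeInt s x fun p => (a p).primitiveCoord (l p) := by
  have hn := polyTime_n ha
  have hn1 := hn.add (.const 1)
  refine .mul (polyTime_den ha) <| .sum hn1 <|
      .mul (.pow (polyTime_outputRadix ha).lift hn1.last) <|
    .sum hn1.lift ?_
  have ha2 := ha.lift (N := fun p => (a p).n + 1) |>.lift (N := fun q => (a q.1).n + 1)
  have hi := (hn.lift.lift.sub hn1.lift.last fun q hq => Nat.lt_succ_iff.mp hq.2).add hn1.last.lift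
  exact .mul (.mul (polyTime_charCoeff ha2 hn1.lift.last)
      (.div (polyTime_denInt ha2) (hi.add (.const 1)).computable))
    (polyTime_powCoord ha2 hi hl.lift.lift fun q hq => hln _ hq.1.1)

/-- The coordinates of the primitive element, as a vector of rational numbers, are computable in
polynomial time. -/
theorem polyTime_primitiveVec : PolyTimeOn Set.univ (fun a : RatArray => .ofArray a.entry)
    (fun a => .ofVec fun l : Fin a.n => (a.primitiveCoord l : ℚ)) := by
  have ha : PolyTimeOn Set.univ (fun a : RatArray => .ofArray a.entry) _ := .refl
  have hn := polyTime_n ha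
  refine (PolyTimeOn.tabulate hn (f := fun a l => .pair (.int (a.primitiveCoord l)) (.int 1))
    (.pair (polyTime_primitiveCoord ha.lift hn.last fun q hq => hq.2) (.const _))).congr
    fun a _ => ?_
  simp [Data.ofVec, Data.ofRat]

end PolyTime

end RatArray

/-! ### Newton's identities for the characteristic polynomial -/

namespace Matrix

variable {R : Type*} [CommRing R] {ι : Type*} [Fintype ι] [DecidableEq ι]

/-- The derivative of a determinant is computed column by column. -/
theorem derivative_det (A : Matrix ι ι R[X]) :
    derivative A.det = ∑ i, (A.updateCol i fun r => derivative (A r i)).det := by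
  simp only [det_apply', map_sum, Polynomial.derivative_mul, Polynomial.derivative_prod_finset,
    Polynomial.derivative_intCast, zero_mul, zero_add]
  rw [Finset.sum_comm]
  refine Finset.sum_congr rfl fun σ _ => ?_
  rw [Finset.mul_sum]
  refine Finset.sum_congr rfl fun i _ => ?_
  rw [← Finset.prod_erase_mul Finset.univ _ (Finset.mem_univ i)]
  congr 2
  · refine Finset.prod_congr rfl fun j hj => ?_
    rw [updateCol_ne (Finset.ne_of_mem_erase hj)]
  · rw [updateCol_self]

theorem derivative_charpoly (M : Matrix ι ι R) :
    derivative M.charpoly = (charmatrix M).adjugate.trace := by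
  rw [charpoly, derivative_det, trace]
  refine Finset.sum_congr rfl fun i _ => ?_
  rw [diag_apply, ← transpose_apply (charmatrix M).adjugate, adjugate_transpose, adjugate_def,
    of_apply, transpose_transpose, cramer_apply]
  congr 2
  ext1 r
  rcases eq_or_ne r i with rfl | h
  · simp [charmatrix_apply_eq]
  · simp [h]

/-- The adjugate of `X - M` is the quotient of `χ(X) - χ(M)` by `X - M`, where `χ` is the
characteristic polynomial of `M`. -/
theorem adjugate_charmatrix [IsDomain R] (M : Matrix ι ι R) :
    (charmatrix M).adjugate = ∑ k ∈ Finset.range (M.charpoly.natDegree + 1),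
      C (M.charpoly.coeff k) • ∑ i ∈ Finset.range k,
        scalar ι (X : R[X]) ^ i * (C.mapMatrix M) ^ (k - 1 - i) := by
  set Q := ∑ k ∈ Finset.range (M.charpoly.natDegree + 1),
      C (M.charpoly.coeff k) • ∑ i ∈ Finset.range k,
        scalar ι (X : R[X]) ^ i * (C.mapMatrix M) ^ (k - 1 - i) with hQ
  have h1 : charmatrix M * Q = M.charpoly • (1 : Matrix ι ι R[X]) := by
    have h2 : ∑ k ∈ Finset.range (M.charpoly.natDegree + 1),
        C (M.charpoly.coeff k) • (C.mapMatrix M) ^ k = 0 := by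
      have h := congrArg (C : R →+* R[X]).mapMatrix (aeval_self_charpoly M)
      rw [aeval_eq_sum_range, map_sum, map_zero] at h
      rw [← h]
      refine Finset.sum_congr rfl fun k _ => ?_
      rw [← map_pow]
      ext1 i j
      simp [smul_eq_mul]
    have h3 : ∑ k ∈ Finset.range (M.charpoly.natDegree + 1),
        C (M.charpoly.coeff k) • scalar ι (X : R[X]) ^ k = M.charpoly • 1 := by
      conv_rhs => rw [M.charpoly.as_sum_range_C_mul_X_pow]
      rw [Finset.sum_smul]
      refine Finset.sum_congr rfl fun k _ => ?_
      rw [← map_pow, mul_smul]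
      congr 1
      ext1 i j
      simp [diagonal_apply, one_apply]
    rw [hQ, Finset.mul_sum, ← h3, ← sub_zero (∑ k ∈ _, _ • scalar ι X ^ k), ← h2,
      ← Finset.sum_sub_distrib]
    refine Finset.sum_congr rfl fun k _ => ?_
    rw [mul_smul_comm, charmatrix, Commute.mul_geom_sum₂ (scalar_commute _ (Commute.all _) _),
      smul_sub]
  have h4 : M.charpoly • Q = M.charpoly • (charmatrix M).adjugate := by
    have h := congrArg ((charmatrix M).adjugate * ·) h1
    simp only [← mul_assoc, adjugate_mul, smul_mul_assoc, one_mul, mul_smul_comm, mul_one] at h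
    exact h
  have hne := (charpoly_monic M).ne_zero
  ext1 i j
  exact (mul_left_cancel₀ hne (congrFun (congrFun h4 i) j)).symm

/-- Newton's identities, with traces of powers in the role of the power sums of the roots. -/
theorem sub_mul_coeff_charpoly [IsDomain R] (M : Matrix ι ι R) (i : ℕ) :
    ((Fintype.card ι : R) - i) * M.charpoly.coeff i =
      -∑ k ∈ Finset.range (Fintype.card ι + 1),
        if i < k then M.charpoly.coeff k * (M ^ (k - i)).trace else 0 := by
  have h1 : (X : R[X]) • (charmatrix M).adjugate =
      M.charpoly • 1 + C.mapMatrix M * (charmatrix M).adjugate := by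
    rw [charpoly, ← mul_adjugate, ← add_mul, charmatrix, sub_add_cancel, scalar_apply,
      ← smul_eq_diagonal_mul]
  have h2 := congrArg trace h1
  rw [trace_smul, ← derivative_charpoly, trace_add, trace_smul, trace_one, adjugate_charmatrix,
    Finset.mul_sum, trace_sum] at h2
  have h3 := congrArg (fun p => coeff p i) h2
  have h4 : ∀ k ∈ Finset.range (M.charpoly.natDegree + 1), (C.mapMatrix M *
      (C (M.charpoly.coeff k) •
      ∑ i ∈ Finset.range k, scalar ι (X : R[X]) ^ i * (C.mapMatrix M) ^ (k - 1 -
          i))).trace.coeff i =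
      if i < k then M.charpoly.coeff k * (M ^ (k - i)).trace else 0 := by
    intro k _
    rw [mul_smul_comm, trace_smul, Finset.mul_sum, trace_sum, smul_eq_mul, coeff_C_mul,
      finsetSum_coeff]
    have h5 : ∀ j ∈ Finset.range k, (C.mapMatrix M *
        (scalar ι (X : R[X]) ^ j * C.mapMatrix M ^ (k - 1 - j))).trace.coeff i =
        if i = j then (M ^ (k - i)).trace else 0 := by
      intro j hj
      have hj' := Finset.mem_range.mp hj
      have e : C.mapMatrix M * (scalar ι (X : R[X]) ^ j * C.mapMatrix M ^ (k - 1 - j)) =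
          (X : R[X]) ^ j • C.mapMatrix (M ^ (k - j)) := by
        rw [← map_pow, ← mul_assoc, ← (scalar_commute _ (Commute.all _) _).eq, mul_assoc,
          ← pow_succ', scalar_apply, ← smul_eq_diagonal_mul, map_pow]
        congr 2
        omega
      have e2 : (C.mapMatrix (M ^ (k - j))).trace = C (M ^ (k - j)).trace := by
        simp [trace, map_sum]
      rw [e, trace_smul, e2, smul_eq_mul, mul_comm, coeff_C_mul_X_pow]
      split_ifs with h
      · rw [h]
      · rfl
    rw [Finset.sum_congr rfl h5, Finset.sum_ite_eq]
    split_ifs <;> simp_all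
  rw [charpoly_natDegree_eq_dim] at h3 h4
  simp only [smul_eq_mul, coeff_add, finsetSum_coeff] at h3
  rw [Finset.sum_congr rfl h4, mul_comm X, coeff_mul_natCast] at h3
  have h6 : (derivative M.charpoly * X).coeff i = M.charpoly.coeff i * i := by
    cases i with
    | zero => simp
    | succ i => rw [coeff_mul_X, coeff_derivative]; push_cast; rfl
  rw [h6] at h3
  linear_combination -h3

end Matrix

/-! ### Algebraic integers all of whose conjugates are small -/

section Conjugates

local notation "Ω" => AlgebraicClosure ℚ

/-- Stated for the algebra structure that instance search finds on a field of characteristic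
zero. -/
instance isAlgebraic_algebraicClosure_rat : Algebra.IsAlgebraic ℚ Ω :=
  AlgebraicClosure.isAlgebraic ℚ

instance isAlgClosure_algebraicClosure_rat : IsAlgClosure ℚ Ω :=
  ⟨inferInstance, inferInstance⟩

instance normal_algebraicClosure_rat : Normal ℚ Ω := IsAlgClosure.normal ℚ Ω

/-- The norm of such an algebraic integer is an integer of absolute value less than `1`. -/
theorem eq_zero_of_forall_norm_conj_lt_one (ι : Ω →+* ℂ) {y : Ω} (hy : IsIntegral ℤ y)
    (h : ∀ σ : Ω ≃ₐ[ℚ] Ω, ‖ι (σ y)‖ < 1) : y = 0 := by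
  have hyQ : IsIntegral ℚ y := Algebra.IsIntegral.isIntegral y
  have h1 := minpoly.isIntegrallyClosed_eq_field_fractions' ℚ hy
  set p := (minpoly ℚ y).map (algebraMap ℚ Ω) with hp
  have hmon : p.Monic := (minpoly.monic hyQ).map _
  have hroots : ∀ z ∈ p.roots, ‖ι z‖ < 1 := by
    intro z hz
    have hz' : aeval z (minpoly ℚ y) = 0 := by
      rw [aeval_def, ← eval_map]
      exact (mem_roots'.mp hz).2
    obtain ⟨σ, rfl⟩ :=
      isConjRoot_iff_exists_algEquiv.mp (isConjRoot_of_aeval_eq_zero hyQ hz').symm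
    exact h σ
  have hne : p.roots ≠ 0 := by
    have : y ∈ p.roots := by
      rw [mem_roots hmon.ne_zero, IsRoot, eval_map, ← aeval_def, minpoly.aeval]
    intro h0
    simp [h0] at this
  have hprod : ∀ s : Multiset Ω, (∀ z ∈ s, ‖ι z‖ < 1) → ‖ι s.prod‖ ≤
      1 ∧ (s ≠ 0 → ‖ι s.prod‖ < 1) := by
    intro s
    induction s using Multiset.induction_on with
    | empty => simp
    | cons z s ih =>
      intro hs
      have h1 := hs z (by simp)
      have h2 := (ih fun w hw => hs w (by simp [hw])).1
      have h3 : ‖ι (z ::ₘ s).prod‖ < 1 := by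
        rw [Multiset.prod_cons, map_mul, norm_mul]
        exact (mul_le_of_le_one_right (norm_nonneg _) h2).trans_lt h1
      exact ⟨h3.le, fun _ => h3⟩
  have hc := (IsAlgClosed.splits p).coeff_zero_eq_prod_roots_of_monic hmon
  have hc' : ‖ι (p.coeff 0)‖ < 1 := by
    rw [hc, map_mul, norm_mul]
    simpa using (hprod _ hroots).2 hne
  rw [hp, h1, map_map, coeff_map] at hc'
  have hc0 : (minpoly ℤ y).coeff 0 = 0 := by
    have : ‖(((minpoly ℤ y).coeff 0 : ℤ) : ℂ)‖ < 1 := by simpa using hc'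
    rw [Complex.norm_intCast] at this
    have h2 : |(minpoly ℤ y).coeff 0| < 1 := by exact_mod_cast this
    exact Int.abs_lt_one_iff.mp h2
  refine (minpoly.coeff_zero_eq_zero hyQ).mp ?_
  rw [h1, coeff_map, hc0, map_zero]

/-- If an expansion in base `k`, with algebraic integers all of whose conjugates are less than `k`
as digits, represents zero, then all digits vanish: the first digit is divisible by `k`. -/
theorem eq_zero_of_sum_pow_mul_eq_zero (ι : Ω →+* ℂ) (k : ℤ) (N : ℕ) (d : ℕ → Ω)
    (hd : ∀ i < N, IsIntegral ℤ (d i)) (h : ∀ i < N, ∀ σ : Ω ≃ₐ[ℚ] Ω, ‖ι (σ (d i))‖ < k)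
    (h0 : ∑ i ∈ Finset.range N, (k : Ω) ^ i * d i = 0) : ∀ i < N, d i = 0 := by
  induction N generalizing d with
  | zero => intro i hi; omega
  | succ N ih =>
    have hk : (0 : ℝ) < k := (norm_nonneg _).trans_lt (h 0 (Nat.succ_pos N) 1)
    have hk' : (k : Ω) ≠ 0 := by
      have : k ≠ 0 := by rintro rfl; simp at hk
      exact_mod_cast this
    set y := ∑ i ∈ Finset.range N, (k : Ω) ^ i * d (i + 1) with hy
    have h1 : d 0 = -(k * y) := by
      rw [Finset.sum_range_succ'] at h0
      simp only [pow_zero, one_mul, pow_succ'] at h0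
      rw [hy, Finset.mul_sum]
      simp only [← mul_assoc] at h0 ⊢
      exact eq_neg_of_add_eq_zero_right h0
    have hyint : IsIntegral ℤ y := IsIntegral.sum _ fun i hi =>
      (isIntegral_algebraMap (R := ℤ) (x := k) |>.pow i).mul
        (hd (i + 1) (by simpa using hi))
    have hy0 : y = 0 := by
      refine eq_zero_of_forall_norm_conj_lt_one ι hyint fun σ => ?_
      have h2 := h 0 (Nat.succ_pos N) σ
      rw [h1, map_neg, map_neg, norm_neg, map_mul, map_mul, norm_mul, map_intCast, map_intCast,
        Complex.norm_intCast, abs_of_pos hk] at h2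
      exact (mul_lt_iff_lt_one_right hk).mp h2
    have hrec := ih (fun i => d (i + 1)) (fun i hi => hd _ (by omega)) (fun i hi =>
        h _ (by omega)) hy0
    intro i hi
    cases i with
    | zero => rw [h1, hy0]; simp
    | succ i => exact hrec i (by omega)

end Conjugates

/-- The sum includes the leading coefficient `1`, so it also covers zeros in the unit disc. -/
theorem norm_le_of_isRoot {p : ℂ[X]} (hp : p.Monic) {z : ℂ} (hz : p.IsRoot z) :
    ‖z‖ ≤ ∑ t ∈ Finset.range (p.natDegree + 1), ‖p.coeff t‖ := by
  obtain ⟨n, hn⟩ : ∃ n, n = p.natDegree := ⟨_, rfl⟩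
  rw [← hn]
  have h1 : z ^ n = -∑ t ∈ Finset.range n, p.coeff t * z ^ t := by
    have := hz.eq_zero
    rw [eval_eq_sum_range, Finset.sum_range_succ, ← hn, show p.coeff n =
        1 from hn ▸ hp.coeff_natDegree,
      one_mul] at this
    exact eq_neg_of_add_eq_zero_right this
  rw [Finset.sum_range_succ, show p.coeff n = 1 from hn ▸ hp.coeff_natDegree, norm_one]
  have hS : 0 ≤ ∑ t ∈ Finset.range n, ‖p.coeff t‖ := by positivity
  rcases le_or_gt ‖z‖ 1 with hz1 | hz1
  · linarith
  · cases n with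
    | zero => simp at h1
    | succ m =>
      have h2 : ‖z‖ ^ (m + 1) ≤ (∑ t ∈ Finset.range (m + 1), ‖p.coeff t‖) * ‖z‖ ^ m := by
        rw [← norm_pow, h1, norm_neg, Finset.sum_mul]
        refine (norm_sum_le _ _).trans (Finset.sum_le_sum fun t ht => ?_)
        rw [norm_mul, norm_pow]
        exact mul_le_mul_of_nonneg_left
          (pow_le_pow_right₀ hz1.le (Nat.lt_succ_iff.mp (Finset.mem_range.mp ht))) (norm_nonneg _)
      rw [pow_succ', mul_le_mul_iff_left₀ (by positivity)] at h2
      linarith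

/-! ### Antiderivatives of multiples of a polynomial -/

namespace Polynomial

/-- For different zeros `r` and `r'` of `h` there is a polynomial of controlled degree that takes
different values at `r` and `r'` and whose derivative is divisible by `h`. -/
theorem exists_dvd_derivative_eval_ne {F : Type*} [Field F] {h : F[X]} (hh : h ≠ 0)
    {r r' : F} (hr : r ≠ r') (hr' : h.IsRoot r') :
    ∃ H : F[X], h ∣ derivative H ∧ H.natDegree ≤ 2 * h.natDegree ∧ H.eval r ≠ H.eval r' := by
  obtain ⟨g, hg, hgr⟩ := exists_eq_pow_rootMultiplicity_mul_and_not_dvd h hh r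
  set m := rootMultiplicity r h with hm
  have hcop : IsCoprime (X - C r) g := (irreducible_X_sub_C r).coprime_iff_not_dvd.mpr hgr
  have hg0 : g ≠ 0 := by rintro rfl; simp at hgr
  -- `U * g ^ 2` is `1` near `r`, and vanishes to high order at the other zeros of `h`
  obtain ⟨V, U, hUV⟩ := (hcop.pow (m := m + 1) (n := 2))
  have hmon : ((X - C r) ^ (m + 1)).Monic := (monic_X_sub_C r).pow _
  set U' := U %ₘ ((X - C r) ^ (m + 1)) with hU'
  have hdvd : (X - C r) ^ (m + 1) ∣ g ^ 2 * U' - 1 := by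
    have h1 := modByMonic_add_div U ((X - C r) ^ (m + 1))
    refine ⟨-V - g ^ 2 * (U /ₘ ((X - C r) ^ (m + 1))), ?_⟩
    linear_combination hUV + g ^ 2 * h1
  have hU'deg : U'.natDegree ≤ m := by
    have := natDegree_modByMonic_lt U hmon fun h1 => by
      have := congrArg natDegree h1
      simp [natDegree_pow] at this
    rw [natDegree_pow, natDegree_X_sub_C, mul_one] at this
    exact Nat.lt_succ_iff.mp this
  have hdeg : h.natDegree = m + g.natDegree := by
    rw [hg, natDegree_mul ((monic_X_sub_C r).pow _).ne_zero hg0, natDegree_pow, natDegree_X_sub_C,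
      mul_one]
  refine ⟨g ^ 2 * U', ?_, ?_, ?_⟩
  · rw [hg]
    refine (hcop.pow_left (m := m)).mul_dvd ?_ ?_
    · obtain ⟨W, hW⟩ := hdvd
      rw [show g ^ 2 * U' = 1 + (X - C r) ^ (m + 1) * W by rw [← hW]; ring, derivative_add,
        derivative_one, zero_add, derivative_mul, derivative_X_sub_C_pow]
      refine dvd_add (Dvd.dvd.mul_right (Dvd.dvd.mul_left (pow_dvd_pow _ (by omega)) _) _)
        (Dvd.dvd.mul_right (pow_dvd_pow _ (by omega)) _)
    · rw [derivative_mul, sq, derivative_mul]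
      exact ⟨2 * derivative g * U' + g * derivative U', by ring⟩
  · refine natDegree_mul_le.trans ?_
    rw [natDegree_pow]
    omega
  · obtain ⟨W, hW⟩ := hdvd
    have h1 : (g ^ 2 * U').eval r = 1 := by
      have := congrArg (eval r) hW
      simp at this
      simpa [sub_eq_zero] using this
    have h2 : g.eval r' = 0 := by
      have := hr'.eq_zero
      rw [hg, eval_mul, eval_pow, eval_sub, eval_X, eval_C] at this
      exact (mul_eq_zero.mp this).resolve_left (pow_ne_zero _ (sub_ne_zero.mpr hr.symm))
    rw [h1, eval_mul, eval_pow, h2]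
    simp

/-- The antiderivatives of `h * X ^ m`, for `m ≤ deg h`, together separate the zeros of `h`. -/
theorem exists_antiderivative_eval_ne {F : Type*} [Field F] [CharZero F] {h : F[X]} (hh : h ≠ 0)
    {c : F} (hc : c ≠ 0) {G : ℕ → F[X]}
    (hG : ∀ m ≤ h.natDegree, derivative (G m) = C c * (h * X ^ m))
    {r r' : F} (hr : r ≠ r') (hr' : h.IsRoot r') :
    ∃ m ≤ h.natDegree, (G m).eval r ≠ (G m).eval r' := by
  obtain ⟨H, ⟨q, hq⟩, hdeg, hne⟩ := exists_dvd_derivative_eval_ne hh hr hr'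
  by_contra! hall
  refine hne ?_
  have hqdeg : q.natDegree ≤ h.natDegree := by
    rcases eq_or_ne q 0 with rfl | hq0
    · simp
    · have h1 := natDegree_derivative_le H
      rw [hq, natDegree_mul hh hq0] at h1
      omega
  have h0 : derivative (C c * H - ∑ m ∈ Finset.range (h.natDegree + 1), C (q.coeff m) * G m) =
      0 := by
    rw [derivative_sub, derivative_C_mul, hq, derivative_sum]
    have h1 : ∀ m ∈ Finset.range (h.natDegree + 1), derivative (C (q.coeff m) * G m) =
        C c * h * (C (q.coeff m) * X ^ m) := by
      intro m hm
      rw [derivative_C_mul, hG m (Nat.lt_succ_iff.mp (Finset.mem_range.mp hm))]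
      ring
    rw [Finset.sum_congr rfl h1, ← Finset.mul_sum,
      ← as_sum_range_C_mul_X_pow' q (Nat.lt_succ_of_le hqdeg)]
    ring
  obtain ⟨k, hk⟩ : ∃ k, C c * H - ∑ m ∈ Finset.range (h.natDegree + 1), C (q.coeff m) * G m = C k :=
    ⟨_, eq_C_of_derivative_eq_zero h0⟩
  have e1 := congrArg (eval r) hk
  have e2 := congrArg (eval r') hk
  simp only [eval_sub, eval_mul, eval_C, eval_finsetSum] at e1 e2
  have h3 : ∑ m ∈ Finset.range (h.natDegree + 1), q.coeff m * (G m).eval r =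
      ∑ m ∈ Finset.range (h.natDegree + 1), q.coeff m * (G m).eval r' :=
    Finset.sum_congr rfl fun m hm => by rw [hall m (Nat.lt_succ_iff.mp (Finset.mem_range.mp hm))]
  rw [h3] at e1
  exact mul_left_cancel₀ hc (by linear_combination e1 - e2)

end Polynomial

/-- If `h(β) = 0` and `h` divides the derivative of `G`, then `G(β)` is separable: near every zero
of `h` the polynomial `G` is constant up to an order that exceeds the multiplicity of the zero. -/
theorem isSeparableElt_aeval_of_dvd_derivative {E : Type u} [CommRing E] [Algebra ℚ E] {β : E}
    {h G : ℚ[X]} (hh : h ≠ 0) (hβ : aeval β h = 0) (hG : h ∣ derivative G) :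
    IsSeparableElt (aeval β G) := by
  classical
  let Ω := AlgebraicClosure ℚ
  let f : ℚ →+* Ω := algebraMap ℚ Ω
  let P : ℚ[X] := ∏ r ∈ (h.map f).roots.toFinset, minpoly ℚ ((G.map f).eval r)
  have hP : P ≠ 0 := Finset.prod_ne_zero_iff.mpr fun r _ =>
    minpoly.ne_zero (Algebra.IsIntegral.isIntegral _)
  let F := UniqueFactorizationMonoid.radical P
  have hF : Squarefree F := UniqueFactorizationMonoid.squarefree_radical
  have hdvd : h ∣ F.comp G := by
    rw [← map_dvd_map' f, map_comp]
    by_cases h0 : (F.map f).comp (G.map f) = 0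
    · rw [h0]; exact dvd_zero _
    have hh' : h.map f ≠ 0 := (Polynomial.map_ne_zero_iff f.injective).mpr hh
    rw [IsAlgClosed.dvd_iff_roots_le_roots hh' h0, Multiset.le_iff_count]
    intro r
    rw [count_roots, count_roots]
    by_cases hr : (h.map f).IsRoot r
    swap
    · rw [rootMultiplicity_eq_zero hr]; exact Nat.zero_le _
    rw [le_rootMultiplicity_iff h0]
    have hFr : (F.map f).IsRoot ((G.map f).eval r) := by
      have h1 : minpoly ℚ ((G.map f).eval r) ∣ F := by
        rw [UniqueFactorizationMonoid.dvd_radical_iff_of_irreducible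
          (minpoly.irreducible (Algebra.IsIntegral.isIntegral _)) hP]
        exact Finset.dvd_prod_of_mem _ (by simpa using ⟨hh, hr⟩)
      obtain ⟨W, hW⟩ := h1
      rw [IsRoot, eval_map, ← aeval_def, hW, map_mul, minpoly.aeval, zero_mul]
    obtain ⟨W, hW⟩ := dvd_iff_isRoot.mpr hFr
    rw [hW, mul_comp, sub_comp, X_comp, C_comp]
    refine Dvd.dvd.mul_right ?_ _
    set g := G.map f - C ((G.map f).eval r) with hg
    rcases eq_or_ne g 0 with hg0 | hg0
    · rw [hg0]; exact dvd_zero _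
    rw [← le_rootMultiplicity_iff hg0]
    have hgr : g.IsRoot r := by simp [hg]
    have h1 := derivative_rootMultiplicity_of_root hgr
    have h2 : h.map f ∣ derivative g := by
      rw [hg, derivative_sub, derivative_C, sub_zero, derivative_map]
      exact (map_dvd_map' f).mpr hG
    rcases eq_or_ne (derivative g) 0 with hd0 | hd0
    · exfalso
      rw [eq_C_of_derivative_eq_zero hd0] at hgr hg0
      simp at hgr hg0
      exact hg0 hgr
    · have h3 := rootMultiplicity_le_rootMultiplicity_of_dvd hd0 h2 r
      omega
  refine ⟨F, PerfectField.separable_iff_squarefree.mpr hF, ?_⟩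
  obtain ⟨W, hW⟩ := hdvd
  rw [← aeval_comp, hW, map_mul, hβ, zero_mul]

/-! ### Counting homomorphisms -/

/-- A reduced algebra is a product of fields, and a field of degree `d` has `d` embeddings. -/
theorem finrank_le_card_algHom (A : Type*) [CommRing A] [Algebra ℚ A] [FiniteDimensional ℚ A]
    [IsReduced A] : Module.finrank ℚ A ≤ Nat.card (A →ₐ[ℚ] AlgebraicClosure ℚ) := by
  classical
  have : IsArtinianRing A := IsArtinianRing.of_finite ℚ A
  have : Fintype (MaximalSpectrum A) := Fintype.ofFinite _
  let _ : ∀ I : MaximalSpectrum A, Field (A ⧸ I.asIdeal) := fun I => Ideal.Quotient.field I.asIdeal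
  have hfin : Finite (A →ₐ[ℚ] AlgebraicClosure ℚ) := inferInstance
  rw [((IsArtinianRing.equivPi A).restrictScalars ℚ).toLinearEquiv.finrank_eq,
    Module.finrank_pi_fintype]
  have h1 : ∀ I : MaximalSpectrum A, Module.finrank ℚ (A ⧸ I.asIdeal) =
      Nat.card ((A ⧸ I.asIdeal) →ₐ[ℚ] AlgebraicClosure ℚ) := fun I => by
    rw [Nat.card_eq_fintype_card, AlgHom.card]
  simp only [h1]
  rw [← Nat.card_sigma]
  refine Nat.card_le_card_of_injective
    (fun p : Σ I : MaximalSpectrum A, (A ⧸ I.asIdeal) →ₐ[ℚ] AlgebraicClosure ℚ =>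
      p.2.comp (Ideal.Quotient.mkₐ ℚ p.1.asIdeal)) ?_
  rintro ⟨I, φ⟩ ⟨J, ψ⟩ h
  have hker : ∀ (I : MaximalSpectrum A) (φ : (A ⧸ I.asIdeal) →ₐ[ℚ] AlgebraicClosure ℚ),
      RingHom.ker (φ.comp (Ideal.Quotient.mkₐ ℚ I.asIdeal)) = I.asIdeal := by
    intro I φ
    ext x
    rw [RingHom.mem_ker, AlgHom.comp_apply, map_eq_zero_iff φ φ.toRingHom.injective,
      Ideal.Quotient.mkₐ_eq_mk, Ideal.Quotient.eq_zero_iff_mem]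
  obtain rfl : I = J := by
    ext1
    rw [← hker I φ, ← hker J ψ]
    exact congrArg _ h
  congr 1
  refine AlgHom.ext fun x => ?_
  obtain ⟨x, rfl⟩ := Ideal.Quotient.mk_surjective x
  exact DFunLike.congr_fun h x

/-- A separable element on which all homomorphisms to the algebraic numbers take different values
generates the separable subalgebra. -/
theorem sepSubalgebra_eq_adjoin {E : Type u} [CommRing E] [Algebra ℚ E] [FiniteDimensional ℚ E]
    {α : E} (hα : IsSeparableElt α)
    (hinj : ∀ φ ψ : E →ₐ[ℚ] AlgebraicClosure ℚ, φ α = ψ α → φ = ψ) :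
    sepSubalgebra E = Algebra.adjoin ℚ {α} := by
  have hle : Algebra.adjoin ℚ {α} ≤ sepSubalgebra E :=
    Algebra.adjoin_le (Set.singleton_subset_iff.mpr hα)
  have hred : IsReduced (E ⧸ nilradical E) :=
    (Ideal.isRadical_iff_quotient_reduced _).mp (Ideal.radical_isRadical _)
  -- separable nilpotent elements vanish
  have h1 : Module.finrank ℚ (sepSubalgebra E) ≤ Module.finrank ℚ (E ⧸ nilradical E) := by
    refine LinearMap.finrank_le_finrank_of_injective
      (f := ((Ideal.Quotient.mkₐ ℚ (nilradical E)).comp (sepSubalgebra E).val).toLinearMap) ?_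
    rw [← LinearMap.ker_eq_bot, LinearMap.ker_eq_bot']
    rintro ⟨x, hx⟩ h0
    have hnil : IsNilpotent x := by
      rw [← mem_nilradical]
      exact Ideal.Quotient.eq_zero_iff_mem.mp h0
    have := Module.End.eq_zero_of_isNilpotent_isSemisimple (hnil.map (Algebra.lmul ℚ E))
      ((isSeparableElt_iff_isSemisimple x).mp hx)
    rw [Subtype.ext_iff]
    exact Algebra.lmul_injective (this.trans (map_zero _).symm)
  have h2 : Nat.card ((E ⧸ nilradical E) →ₐ[ℚ] AlgebraicClosure ℚ) ≤
      Nat.card (E →ₐ[ℚ] AlgebraicClosure ℚ) :=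
    Nat.card_le_card_of_injective (fun φ => φ.comp (Ideal.Quotient.mkₐ ℚ (nilradical E)))
      fun φ ψ h => AlgHom.cancel_right (Ideal.Quotient.mkₐ_surjective ℚ _) |>.mp h
  have h3 : Nat.card (E →ₐ[ℚ] AlgebraicClosure ℚ) ≤
      Nat.card (Algebra.adjoin ℚ {α} →ₐ[ℚ] AlgebraicClosure ℚ) :=
    Nat.card_le_card_of_injective (fun φ => φ.comp (Algebra.adjoin ℚ {α}).val) fun φ ψ h =>
      hinj φ ψ (DFunLike.congr_fun h ⟨α, Algebra.self_mem_adjoin_singleton ℚ α⟩)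
  have h4 := card_algHom_le_finrank ℚ (Algebra.adjoin ℚ {α}) (AlgebraicClosure ℚ)
  have h5 := finrank_le_card_algHom (E ⧸ nilradical E)
  have h6 : Subalgebra.toSubmodule (Algebra.adjoin ℚ {α}) =
      Subalgebra.toSubmodule (sepSubalgebra E) :=
    Submodule.eq_of_le_of_finrank_le hle (by
      change Module.finrank ℚ (sepSubalgebra E) ≤ Module.finrank ℚ (Algebra.adjoin ℚ {α})
      omega)
  exact (Subalgebra.toSubmodule_injective h6).symm

/-! ### Correctness of the algorithm -/

/-- If multiplication by `w` has an integral matrix, then the characteristic polynomial of that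
matrix vanishes at `w`. -/
theorem aeval_charpoly_eq_zero_of_leftMulMatrix {E : Type u} [CommRing E] [Algebra ℚ E] {n : ℕ}
    (e : Module.Basis (Fin n) ℚ E) {w : E} {W : Matrix (Fin n) (Fin n) ℤ}
    (hW : Algebra.leftMulMatrix e w = W.map (Int.castRingHom ℚ)) : aeval w W.charpoly = 0 := by
  apply Algebra.leftMulMatrix_injective e
  have h1 : aeval w (W.charpoly.map (algebraMap ℤ ℚ)) = aeval w W.charpoly :=
    aeval_map_algebraMap ℚ w W.charpoly
  rw [← h1, map_zero, ← aeval_algHom_apply, hW]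
  have h2 : W.charpoly.map (algebraMap ℤ ℚ) = (W.map (Int.castRingHom ℚ)).charpoly :=
    (Matrix.charpoly_map W (Int.castRingHom ℚ)).symm
  rw [h2, Matrix.aeval_self_charpoly]

namespace RatArray

theorem den_dvd_den (a : RatArray) {i j l : ℕ} (hi : i < a.n) (hj : j < a.n) (hl : l < a.n) :
    ((a.coeff i j l).den : ℤ) ∣ a.den :=
  ((Finset.dvd_prod_of_mem (fun l => ((a.coeff i j l).den : ℤ)) (Finset.mem_range.mpr hl)).trans
    (Finset.dvd_prod_of_mem (fun j => ∏ l ∈ Finset.range a.n, ((a.coeff i j l).den : ℤ))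
      (Finset.mem_range.mpr hj))).trans
    (Finset.dvd_prod_of_mem (fun i => ∏ j ∈ Finset.range a.n, ∏ l ∈ Finset.range a.n,
      ((a.coeff i j l).den : ℤ)) (Finset.mem_range.mpr hi))

theorem den_ne_zero (a : RatArray) : a.den ≠ 0 :=
  Finset.prod_ne_zero_iff.mpr fun _ _ => Finset.prod_ne_zero_iff.mpr fun _ _ =>
    Finset.prod_ne_zero_iff.mpr fun _ _ => by simp

theorem intCoeff_cast (a : RatArray) {i j l : ℕ} (hi : i < a.n) (hj : j < a.n) (hl : l < a.n) :
    (a.intCoeff i j l : ℚ) = a.den * a.coeff i j l := by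
  have h0 : (((a.coeff i j l).den : ℤ) : ℚ) ≠ 0 := by simp
  rw [intCoeff, Int.cast_mul, Int.cast_div (a.den_dvd_den hi hj hl) h0]
  conv_rhs => rw [← Rat.num_div_den (a.coeff i j l)]
  rw [Int.cast_natCast]
  ring

theorem denInt_ne_zero (a : RatArray) : a.denInt ≠ 0 := by
  simpa [denInt] using Nat.factorial_ne_zero _

theorem abs_intCoeff_sum_le (a : RatArray) {i j : ℕ} (hi : i < a.n) (hj : j < a.n) :
    ∑ l ∈ Finset.range a.n, |a.intCoeff i j l| ≤ a.bound :=
  (Finset.single_le_sum (f := fun j => ∑ l ∈ Finset.range a.n, |a.intCoeff i j l|)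
    (fun _ _ => by positivity) (Finset.mem_range.mpr hj)).trans
  (Finset.single_le_sum (f := fun i => ∑ j ∈ Finset.range a.n, ∑ l ∈ Finset.range a.n,
    |a.intCoeff i j l|) (fun _ _ => by positivity) (Finset.mem_range.mpr hi))

theorem bound_nonneg (a : RatArray) : 0 ≤ a.bound := by unfold bound; positivity

/-- The antiderivative of `denInt * χ * X ^ m` without constant term, where `χ` is the
characteristic polynomial of `β`. -/
noncomputable def antiderivative (a : RatArray) (m : ℕ) : ℤ[X] :=
  ∑ t ∈ Finset.range (a.n + 1), C (a.antiCoeff m t) * X ^ (a.n - t + m + 1)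

end RatArray

section Correctness

variable {E : Type u} [CommRing E] [Algebra ℚ E] {n : ℕ} (e : Module.Basis (Fin n) ℚ E)

/-- The array of structure constants on a basis. -/
noncomputable def arrayOf : RatArray := ⟨n, structureConstants e⟩

/-- The given basis multiplied by the common denominator of the structure constants, continued by
zero. Its structure constants are integers. -/
noncomputable def scaled (l : ℕ) : E := if h : l < n then ((arrayOf e).den : E) * e ⟨l, h⟩ else 0

/-- The element `β` of the lattice spanned by the scaled basis. -/
noncomputable def latticeElt : E := ∑ i ∈ Finset.range n, ((arrayOf e).radix : E) ^ i * scaled e i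

/-- The matrix of multiplication by `β`, on the given basis as well as on the scaled one. It has
integer entries. -/
noncomputable def mulMatrix : Matrix (Fin n) (Fin n) ℤ :=
  Matrix.of fun l s => (arrayOf e).mulCoeff s l

theorem intCast_mul_eq_smul (k : ℤ) (w : E) : (k : E) * w = (k : ℚ) • w := by
  rw [Algebra.smul_def, map_intCast]

theorem repr_scaled_mul {i s l : Fin n} : e.repr (scaled e i * e s) l =
    (arrayOf e).intCoeff i s l := by
  rw [(arrayOf e).intCoeff_cast i.2 s.2 l.2, scaled, dif_pos i.2, mul_assoc, intCast_mul_eq_smul,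
    map_smul, Finsupp.smul_apply, smul_eq_mul, RatArray.coeff, dif_pos ⟨i.2, s.2, l.2⟩]
  rfl

theorem leftMulMatrix_scaled (i : Fin n) : Algebra.leftMulMatrix e (scaled e i) =
    (Matrix.of fun l s : Fin n => (arrayOf e).intCoeff i s l).map (Int.castRingHom ℚ) := by
  ext1 l s
  rw [Algebra.leftMulMatrix_eq_repr_mul, repr_scaled_mul]
  rfl

theorem scaled_mul {i s : ℕ} (hi : i < n) (hs : s < n) :
    scaled e i * scaled e s = ∑ l ∈ Finset.range n, ((arrayOf e).intCoeff i s l : E) *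
        scaled e l := by
  have h1 : scaled e s = ((arrayOf e).den : E) * e ⟨s, hs⟩ := dif_pos hs
  rw [h1, mul_left_comm, ← e.sum_repr (scaled e i * e ⟨s, hs⟩), Finset.mul_sum, Finset.sum_range]
  refine Finset.sum_congr rfl fun l _ => ?_
  have h2 : scaled e l = ((arrayOf e).den : E) * e l := dif_pos l.2
  have h3 := repr_scaled_mul e (i := ⟨i, hi⟩) (s := ⟨s, hs⟩) (l := l)
  dsimp only at h3
  rw [h3, h2, ← intCast_mul_eq_smul, mul_left_comm]

theorem latticeElt_mul_scaled {s : ℕ} (hs : s < n) :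
    latticeElt e * scaled e s = ∑ l ∈ Finset.range n, ((arrayOf e).mulCoeff s l : E) *
        scaled e l := by
  rw [latticeElt, Finset.sum_mul]
  simp only [RatArray.mulCoeff, Int.cast_sum, Finset.sum_mul]
  rw [Finset.sum_comm]
  refine Finset.sum_congr rfl fun i hi => ?_
  rw [mul_assoc, scaled_mul e (Finset.mem_range.mp hi) hs, Finset.mul_sum]
  refine Finset.sum_congr rfl fun l _ => ?_
  push_cast
  ring

theorem latticeElt_pow (j : ℕ) :
    latticeElt e ^ (j + 1) = ∑ l ∈ Finset.range n, ((arrayOf e).powCoord j l : E) * scaled e l := by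
  induction j with
  | zero => simp [latticeElt, RatArray.powCoord]
  | succ j ih =>
    rw [pow_succ', ih, Finset.mul_sum]
    simp only [RatArray.powCoord, Int.cast_sum, Finset.sum_mul]
    rw [Finset.sum_comm]
    refine Finset.sum_congr rfl fun s hs => ?_
    rw [mul_left_comm, latticeElt_mul_scaled e (Finset.mem_range.mp hs), Finset.mul_sum]
    refine Finset.sum_congr rfl fun l _ => ?_
    push_cast
    ring

theorem leftMulMatrix_latticeElt :
    Algebra.leftMulMatrix e (latticeElt e) = (mulMatrix e).map (Int.castRingHom ℚ) := by
  ext1 l s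
  have h1 : ∀ i ∈ Finset.range n, e.repr (((arrayOf e).radix : E) ^ i * scaled e i * e s) l =
      (((arrayOf e).radix ^ i * (arrayOf e).intCoeff i s l : ℤ) : ℚ) := by
    intro i hi
    rw [mul_assoc, ← Int.cast_pow, intCast_mul_eq_smul, map_smul, Finsupp.smul_apply, smul_eq_mul,
      Int.cast_mul]
    congr 1
    exact repr_scaled_mul e (i := ⟨i, Finset.mem_range.mp hi⟩)
  rw [Algebra.leftMulMatrix_eq_repr_mul, latticeElt, Finset.sum_mul, map_sum,
    Finsupp.finsetSum_apply, Finset.sum_congr rfl h1, ← Int.cast_sum]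
  rfl

theorem trace_scaled {l : ℕ} (hl : l < n) :
    Algebra.trace ℚ E (scaled e l) = ((∑ s ∈ Finset.range n,
        (arrayOf e).intCoeff l s s : ℤ) : ℚ) := by
  rw [Algebra.trace_eq_matrix_trace e, leftMulMatrix_scaled e ⟨l, hl⟩, Finset.sum_range,
    Int.cast_sum]
  rfl

theorem trace_mulMatrix_pow (j : ℕ) : (mulMatrix e ^ (j + 1)).trace = (arrayOf e).tracePow j := by
  have h1 : Algebra.trace ℚ E (latticeElt e ^ (j + 1)) = ((mulMatrix e ^ (j + 1)).trace : ℤ) := by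
    rw [Algebra.trace_eq_matrix_trace e, map_pow, leftMulMatrix_latticeElt, ← Matrix.map_pow]
    exact (AddMonoidHom.map_trace (Int.castRingHom ℚ).toAddMonoidHom _).symm
  have h2 : Algebra.trace ℚ E (latticeElt e ^ (j + 1)) = ((arrayOf e).tracePow j : ℤ) := by
    rw [latticeElt_pow, map_sum, RatArray.tracePow, Int.cast_sum]
    refine Finset.sum_congr rfl fun l hl => ?_
    rw [intCast_mul_eq_smul, map_smul, trace_scaled e (Finset.mem_range.mp hl), smul_eq_mul,
      Int.cast_mul]
    rfl
  exact_mod_cast h1.symm.trans h2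

/-- In particular the divisions in the recursion for `charCoeff` are exact. -/
theorem charCoeff_eq_coeff_charpoly {t : ℕ} (ht : t ≤ n) :
    (arrayOf e).charCoeff t = (mulMatrix e).charpoly.coeff (n - t) := by
  induction t using Nat.strong_induction_on with
  | _ t ih =>
    cases t with
    | zero =>
      rw [RatArray.charCoeff, newtonCoeff_zero]
      have := (Matrix.charpoly_monic (mulMatrix e)).coeff_natDegree
      rw [Matrix.charpoly_natDegree_eq_dim, Fintype.card_fin] at this
      exact this.symm
    | succ t =>
      rw [RatArray.charCoeff, newtonCoeff_succ]
      have h1 := (mulMatrix e).sub_mul_coeff_charpoly (n - (t + 1))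
      rw [Fintype.card_fin, Nat.cast_sub ht, sub_sub_cancel,
        show n + 1 = (n - (t + 1) + 1) + (t + 1) by omega, Finset.sum_range_add] at h1
      rw [Finset.sum_eq_zero (s := Finset.range (n - (t + 1) + 1)) fun k hk =>
        if_neg (by have := Finset.mem_range.mp hk; omega), zero_add] at h1
      refine Int.ediv_eq_of_eq_mul_right (by positivity) ?_
      rw [h1, neg_inj]
      refine Finset.sum_congr rfl fun r hr => ?_
      have hr' := Finset.mem_range.mp hr
      rw [if_pos (by omega), ← trace_mulMatrix_pow]
      congr 1
      · rw [show n - (t + 1) + 1 + r = n - (t - r) by omega]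
        exact ih (t - r) (by omega) (by omega)
      · congr 2
        omega

theorem charpoly_eq_sum :
    (mulMatrix e).charpoly = ∑ t ∈ Finset.range (n + 1), C ((arrayOf e).charCoeff t) * X ^ (n -
        t) := by
  have h := (mulMatrix e).charpoly.as_sum_range_C_mul_X_pow
  rw [Matrix.charpoly_natDegree_eq_dim, Fintype.card_fin] at h
  conv_lhs => rw [h]
  rw [← Finset.sum_range_reflect]
  refine Finset.sum_congr rfl fun t ht => ?_
  have ht' := Finset.mem_range.mp ht
  rw [charCoeff_eq_coeff_charpoly e (by omega)]
  rfl

theorem derivative_antiderivative {m : ℕ} (hm : m ≤ n) : derivative ((arrayOf e).antiderivative m) =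
    C (arrayOf e).denInt * ((mulMatrix e).charpoly * X ^ m) := by
  rw [charpoly_eq_sum, RatArray.antiderivative, derivative_sum, Finset.sum_mul, Finset.mul_sum]
  refine Finset.sum_congr rfl fun t ht => ?_
  have hdvd : ((n - t + m + 1 : ℕ) : ℤ) ∣ (arrayOf e).denInt := by
    rw [RatArray.denInt, Int.natCast_dvd_natCast]
    refine Nat.dvd_factorial (by omega) ?_
    change _ ≤ 2 * n + 1
    omega
  rw [derivative_C_mul_X_pow, RatArray.antiCoeff, show (arrayOf e).n = n from rfl, mul_assoc,
    Int.ediv_mul_cancel hdvd, Nat.add_sub_cancel, pow_add, C_mul]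
  ring

theorem aeval_latticeElt_charpoly : aeval (latticeElt e) (mulMatrix e).charpoly = 0 :=
  aeval_charpoly_eq_zero_of_leftMulMatrix e (leftMulMatrix_latticeElt e)

/-- The element that the algorithm computes. -/
noncomputable def computedElt : E := ∑ l : Fin n, ((arrayOf e).primitiveCoord l : ℚ) • e l

theorem repr_computedElt (l : Fin n) : e.repr (computedElt e) l = (arrayOf e).primitiveCoord l := by
  rw [computedElt, e.repr_sum_self]

theorem computedElt_eq : computedElt e =
    ∑ m ∈ Finset.range (n + 1), ((arrayOf e).outputRadix : E) ^ m * aeval (latticeElt e)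
        ((arrayOf e).antiderivative m) := by
  have h1 : computedElt e = ∑ l ∈ Finset.range n, ((∑ m ∈ Finset.range (n + 1),
      (arrayOf e).outputRadix ^ m *
      ∑ t ∈ Finset.range (n + 1),
          (arrayOf e).antiCoeff m t * (arrayOf e).powCoord (n - t + m) l : ℤ) : E) * scaled e l := by
    rw [computedElt, Finset.sum_range]
    refine Finset.sum_congr rfl fun l _ => ?_
    have h2 : scaled e l = ((arrayOf e).den : E) * e l := dif_pos l.2
    rw [h2, ← intCast_mul_eq_smul, RatArray.primitiveCoord, Int.cast_mul]
    rw [mul_comm ((arrayOf e).den : E), mul_assoc]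
    rfl
  rw [h1]
  simp only [Int.cast_sum, Finset.sum_mul, Int.cast_mul, Int.cast_pow, Finset.mul_sum]
  rw [Finset.sum_comm]
  refine Finset.sum_congr rfl fun m _ => ?_
  rw [Finset.sum_comm, RatArray.antiderivative, map_sum, Finset.mul_sum]
  refine Finset.sum_congr rfl fun t _ => ?_
  rw [map_mul, aeval_C, map_pow, aeval_X, show (arrayOf e).n = n from rfl,
    latticeElt_pow, Finset.mul_sum, Finset.mul_sum, eq_intCast]
  refine Finset.sum_congr rfl fun l _ => ?_
  ring

theorem isSeparableElt_computedElt : IsSeparableElt (computedElt e) := by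
  let f : ℤ →+* ℚ := Int.castRingHom ℚ
  let G : ℚ[X] := ∑ m ∈ Finset.range (n + 1), C ((arrayOf e).outputRadix ^ m : ℚ) *
      ((arrayOf e).antiderivative m).map f
  have h1 : ∀ p : ℤ[X], aeval (latticeElt e) (p.map f) = aeval (latticeElt e) p :=
      aeval_map_algebraMap ℚ (latticeElt e)
  have h2 : computedElt e = aeval (latticeElt e) G := by
    rw [computedElt_eq, map_sum]
    refine Finset.sum_congr rfl fun m _ => ?_
    rw [map_mul, aeval_C, h1, map_pow, map_intCast]
  rw [h2]
  refine isSeparableElt_aeval_of_dvd_derivative (h := (mulMatrix e).charpoly.map f) ?_ ?_ ?_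
  · exact ((Matrix.charpoly_monic _).map f).ne_zero
  · rw [h1, aeval_latticeElt_charpoly]
  · rw [derivative_sum]
    refine Finset.dvd_sum fun m hm => ?_
    rw [derivative_C_mul, derivative_map,
      derivative_antiderivative e (Nat.lt_succ_iff.mp (Finset.mem_range.mp hm)),
      Polynomial.map_mul, Polynomial.map_mul]
    exact ((dvd_mul_right _ _).mul_left _).mul_left _

/-! ### The computed element separates homomorphisms -/

theorem isIntegral_scaled {i : ℕ} (hi : i < n) : IsIntegral ℤ (scaled e i) :=
  ⟨_, Matrix.charpoly_monic _,
    aeval_charpoly_eq_zero_of_leftMulMatrix e (leftMulMatrix_scaled e ⟨i, hi⟩)⟩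

theorem isIntegral_latticeElt : IsIntegral ℤ (latticeElt e) :=
  ⟨_, Matrix.charpoly_monic _, aeval_latticeElt_charpoly e⟩

theorem norm_scaled_le (φ : E →+* ℂ) {i : ℕ} (hi : i < n) : ‖φ (scaled e i)‖ ≤
    (arrayOf e).bound := by
  -- compare with a scaled basis element whose image is as large as possible
  obtain ⟨s, hs, hmax⟩ := Finset.exists_max_image (Finset.range n) (fun s => ‖φ (scaled e s)‖)
    ⟨i, Finset.mem_range.mpr hi⟩
  have hs' := Finset.mem_range.mp hs
  have hB : (0 : ℝ) ≤ (arrayOf e).bound := by exact_mod_cast (arrayOf e).bound_nonneg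
  rcases (norm_nonneg (φ (scaled e s))).eq_or_lt' with h0 | h0
  · exact (hmax i (Finset.mem_range.mpr hi)).trans (h0.trans_le hB)
  · refine le_of_mul_le_mul_right ?_ h0
    calc ‖φ (scaled e i)‖ * ‖φ (scaled e s)‖ = ‖∑ l ∈ Finset.range n,
        ((arrayOf e).intCoeff i s l : ℂ) * φ (scaled e l)‖ := by
          rw [← norm_mul, ← map_mul, scaled_mul e hi hs', map_sum]
          simp only [map_mul, map_intCast]
      _ ≤ ∑ l ∈ Finset.range n, ((|(arrayOf e).intCoeff i s l| : ℤ) : ℝ) * ‖φ (scaled e s)‖ := by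
          refine (norm_sum_le _ _).trans (Finset.sum_le_sum fun l hl => ?_)
          rw [norm_mul, Complex.norm_intCast, Int.cast_abs]
          exact mul_le_mul_of_nonneg_left (hmax l hl) (abs_nonneg _)
      _ ≤ (arrayOf e).bound * ‖φ (scaled e s)‖ := by
          rw [← Finset.sum_mul, ← Int.cast_sum]
          refine mul_le_mul_of_nonneg_right ?_ h0.le
          exact_mod_cast (arrayOf e).abs_intCoeff_sum_le hi hs'

theorem one_le_rootBound : 1 ≤ (arrayOf e).rootBound := by
  rw [RatArray.rootBound, Finset.sum_range_succ']
  have h1 : |(arrayOf e).charCoeff 0| = 1 := by rw [RatArray.charCoeff, newtonCoeff_zero, abs_one]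
  have h2 : 0 ≤ ∑ t ∈ Finset.range (arrayOf e).n, |(arrayOf e).charCoeff (t + 1)| := by positivity
  omega

theorem norm_le_rootBound {z : ℂ} (hz : aeval z (mulMatrix e).charpoly = 0) :
    ‖z‖ ≤ (arrayOf e).rootBound := by
  have hmon := (Matrix.charpoly_monic (mulMatrix e)).map (Int.castRingHom ℂ)
  refine (norm_le_of_isRoot hmon (z := z) ?_).trans ?_
  · rwa [IsRoot, eval_map]
  · rw [(Matrix.charpoly_monic (mulMatrix e)).natDegree_map, Matrix.charpoly_natDegree_eq_dim,
      Fintype.card_fin, ← Finset.sum_range_reflect, RatArray.rootBound, Int.cast_sum]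
    refine Finset.sum_le_sum fun t ht => ?_
    have ht' : t ≤ n := Nat.lt_succ_iff.mp (Finset.mem_range.mp ht)
    rw [charCoeff_eq_coeff_charpoly e ht', coeff_map, eq_intCast, Complex.norm_intCast,
      Int.cast_abs]
    rfl

theorem norm_aeval_antiderivative_le {z : ℂ} (hz : aeval z (mulMatrix e).charpoly = 0) {m : ℕ}
    (hm : m ≤ n) :
    ‖aeval z ((arrayOf e).antiderivative m)‖ ≤
      (((arrayOf e).denInt * (arrayOf e).rootBound ^ (2 * n + 2) : ℤ) : ℝ) := by
  have hS : (1 : ℝ) ≤ (arrayOf e).rootBound := by exact_mod_cast one_le_rootBound e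
  have hL : 0 ≤ (arrayOf e).denInt := by unfold RatArray.denInt; positivity
  have h1 : ∀ t ∈ Finset.range (n + 1),
      ‖aeval z (C ((arrayOf e).antiCoeff m t) * X ^ (n - t + m + 1) : ℤ[X])‖ ≤
        ((|(arrayOf e).charCoeff t| : ℤ) : ℝ) *
          ((arrayOf e).denInt * (arrayOf e).rootBound ^ (2 * n + 1)) := by
    intro t _
    rw [map_mul, aeval_C, map_pow, aeval_X, norm_mul, norm_pow, eq_intCast, Complex.norm_intCast,
      RatArray.antiCoeff, Int.cast_mul, abs_mul, ← Int.cast_abs, ← Int.cast_abs, mul_assoc]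
    refine mul_le_mul_of_nonneg_left (mul_le_mul ?_ ?_ (by positivity) (by exact_mod_cast hL))
      (by positivity)
    · have h2 : |(arrayOf e).denInt / (((arrayOf e).n - t + m + 1 : ℕ) : ℤ)| ≤
          (arrayOf e).denInt := by
        have := Int.natAbs_ediv_le_natAbs (arrayOf e).denInt (((arrayOf e).n - t + m + 1 : ℕ) : ℤ)
        rw [Int.abs_eq_natAbs]
        omega
      exact_mod_cast h2
    · exact (pow_le_pow_left₀ (norm_nonneg _) (norm_le_rootBound e hz) _).trans
        (pow_le_pow_right₀ hS (by omega))
  rw [RatArray.antiderivative, map_sum]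
  refine (norm_sum_le _ _).trans ((Finset.sum_le_sum h1).trans (le_of_eq ?_))
  rw [← Finset.sum_mul, ← Int.cast_sum]
  change ((arrayOf e).rootBound : ℝ) * _ = _
  push_cast
  ring

theorem computedElt_separates {φ ψ : E →ₐ[ℚ] AlgebraicClosure ℚ}
    (h : φ (computedElt e) = ψ (computedElt e)) : φ = ψ := by
  let ι : AlgebraicClosure ℚ →+* ℂ := (IsAlgClosed.lift : AlgebraicClosure ℚ →ₐ[ℚ] ℂ).toRingHom
  by_contra hne
  have hroot : ∀ χ : E →ₐ[ℚ] AlgebraicClosure ℚ,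
      aeval (χ (latticeElt e)) (mulMatrix e).charpoly = 0 := fun χ => by
    have := aeval_algHom_apply (χ.restrictScalars ℤ) (latticeElt e) (mulMatrix e).charpoly
    rw [aeval_latticeElt_charpoly, map_zero] at this
    exact this
  -- `β` separates the homomorphisms
  have hβ : φ (latticeElt e) ≠ ψ (latticeElt e) := by
    intro hβ
    refine hne (AlgHom.toLinearMap_injective (e.ext fun l => ?_))
    have h1 := eq_zero_of_sum_pow_mul_eq_zero ι (arrayOf e).radix n (fun i =>
        φ (scaled e i) - ψ (scaled e i))
      (fun i hi => ((isIntegral_scaled e hi).map (φ.restrictScalars ℤ)).sub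
        ((isIntegral_scaled e hi).map (ψ.restrictScalars ℤ)))
      (fun i hi σ => ?_) ?_ l l.2
    · have h2 : scaled e l = ((arrayOf e).den : E) * e l := dif_pos l.2
      simp only [h2, map_mul, map_intCast, ← mul_sub] at h1
      exact sub_eq_zero.mp
        ((mul_eq_zero.mp h1).resolve_left (by exact_mod_cast (arrayOf e).den_ne_zero))
    · have h1 := norm_scaled_le e (ι.comp ((σ : _ →+* _).comp φ.toRingHom)) hi
      have h2 := norm_scaled_le e (ι.comp ((σ : _ →+* _).comp ψ.toRingHom)) hi
      rw [map_sub, map_sub, RatArray.radix]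
      refine (norm_sub_le _ _).trans_lt ((add_le_add h1 h2).trans_lt ?_)
      push_cast
      linarith
    · rw [latticeElt, map_sum, map_sum] at hβ
      simp only [map_mul, map_pow, map_intCast] at hβ
      simp only [mul_sub, Finset.sum_sub_distrib, hβ, sub_self]
  have hmon := (Matrix.charpoly_monic (mulMatrix e)).map (algebraMap ℤ (AlgebraicClosure ℚ))
  have hdeg : ((mulMatrix e).charpoly.map (algebraMap ℤ (AlgebraicClosure ℚ))).natDegree = n := by
    rw [(Matrix.charpoly_monic (mulMatrix e)).natDegree_map, Matrix.charpoly_natDegree_eq_dim,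
      Fintype.card_fin]
  obtain ⟨m, hm, hmne⟩ := exists_antiderivative_eval_ne (c :=
      ((arrayOf e).denInt : AlgebraicClosure ℚ))
    (G := fun m => ((arrayOf e).antiderivative m).map (algebraMap ℤ _)) hmon.ne_zero
    (by exact_mod_cast (arrayOf e).denInt_ne_zero) (fun m hm => by
      rw [hdeg] at hm
      rw [derivative_map, derivative_antiderivative e hm]
      simp) hβ (by
      rw [IsRoot, eval_map]
      exact hroot ψ)
  rw [hdeg] at hm
  simp only [eval_map_algebraMap] at hmne
  -- the values of the antiderivatives are digits of the value of the computed element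
  refine hmne (sub_eq_zero.mp (eq_zero_of_sum_pow_mul_eq_zero ι (arrayOf e).outputRadix (n + 1)
    (fun m => aeval (φ (latticeElt e)) ((arrayOf e).antiderivative m) - aeval (ψ (latticeElt e))
        ((arrayOf e).antiderivative m))
    (fun m _ => ?_) (fun m hm σ => ?_) ?_ m (Nat.lt_succ_of_le hm)))
  · have hint : ∀ χ : E →ₐ[ℚ] AlgebraicClosure ℚ,
        IsIntegral ℤ (aeval (χ (latticeElt e)) ((arrayOf e).antiderivative m)) := fun χ =>
      adjoin_le_integralClosure ((isIntegral_latticeElt e).map (χ.restrictScalars ℤ))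
        (aeval_mem_adjoin_singleton ℤ _)
    exact (hint φ).sub (hint ψ)
  · have hbd : ∀ χ : E →ₐ[ℚ] AlgebraicClosure ℚ, ‖ι (σ (aeval (χ (latticeElt e))
        ((arrayOf e).antiderivative m)))‖ ≤
        (((arrayOf e).denInt * (arrayOf e).rootBound ^ (2 * n + 2) : ℤ) : ℝ) := by
      intro χ
      let θ : AlgebraicClosure ℚ →ₐ[ℤ] ℂ := (ι.comp (σ : _ →+* _)).toIntAlgHom
      have h1 : ∀ p : ℤ[X], ι (σ (aeval (χ (latticeElt e)) p)) =
          aeval (θ (χ (latticeElt e))) p := fun p =>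
        (aeval_algHom_apply θ (χ (latticeElt e)) p).symm
      rw [h1]
      refine norm_aeval_antiderivative_le e ?_ (Nat.lt_succ_iff.mp hm)
      rw [← h1, hroot, map_zero, map_zero]
    rw [map_sub, map_sub, RatArray.outputRadix]
    refine (norm_sub_le _ _).trans_lt ((add_le_add (hbd φ) (hbd ψ)).trans_lt ?_)
    rw [show (arrayOf e).n = n from rfl]
    push_cast
    linarith
  · have h1 : ∀ χ : E →ₐ[ℚ] AlgebraicClosure ℚ, χ (computedElt e) = ∑ m ∈ Finset.range (n + 1),
        ((arrayOf e).outputRadix : AlgebraicClosure ℚ) ^ m * aeval (χ (latticeElt e))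
            ((arrayOf e).antiderivative m) := by
      intro χ
      rw [computedElt_eq, map_sum]
      refine Finset.sum_congr rfl fun m _ => ?_
      rw [map_mul, map_pow, map_intCast]
      congr 1
      exact (aeval_algHom_apply (χ.restrictScalars ℤ) (latticeElt e) _).symm
    rw [h1, h1] at h
    simp only [mul_sub, Finset.sum_sub_distrib, h, sub_self]

end Correctness

theorem sepSubalgebra_eq_adjoin_computedElt {E : Type u} [CommRing E] [Algebra ℚ E]
    [FiniteDimensional ℚ E] {n : ℕ} (e : Module.Basis (Fin n) ℚ E) :
    sepSubalgebra E = Algebra.adjoin ℚ {computedElt e} :=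
  sepSubalgebra_eq_adjoin (isSeparableElt_computedElt e) fun _ _ => computedElt_separates e

theorem theorem1p6 :
    (∀ (E : Type u) [CommRing E] [Algebra ℚ E] [FiniteDimensional ℚ E],
      ∃ α : sepSubalgebra E, IsPrimitiveElt α) ∧
    ∃ (c : Program) (P : Polynomial ℕ),
      ∀ (E : Type u) [CommRing E] [Algebra ℚ E] [FiniteDimensional ℚ E]
        (n : ℕ) (e : Module.Basis (Fin n) ℚ E),
        ∃ (α : E) (t : ℕ),
          c.Computes (Data.ofArray (structureConstants e)) (Data.ofVec (e.repr α)) t ∧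
          t ≤ P.eval (Data.ofArray (structureConstants e)).size ∧
          sepSubalgebra E = Algebra.adjoin ℚ {α} := by
  constructor
  · intro E _ _ _
    have h := sepSubalgebra_eq_adjoin_computedElt (Module.finBasis ℚ E)
    set α := computedElt (Module.finBasis ℚ E)
    refine ⟨⟨α, isSeparableElt_computedElt _⟩, ?_⟩
    apply Subalgebra.map_injective (f := (sepSubalgebra E).val) Subtype.val_injective
    rw [AlgHom.map_adjoin, Set.image_singleton, Algebra.map_top, Subalgebra.range_val]
    exact h.symm
  · obtain ⟨c, b, P, H⟩ := RatArray.polyTime_primitiveVec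
    refine ⟨c, P, fun E _ _ _ n e => ?_⟩
    obtain ⟨τ, t, h1, h2, -, h3⟩ := H (arrayOf e) trivial
      (Program.initStore (Data.ofArray (structureConstants e))) rfl
    refine ⟨computedElt e, t, ⟨τ, h1, ?_⟩, h3, sepSubalgebra_eq_adjoin_computedElt e⟩
    rw [h2]
    refine congrArg Data.ofVec (funext fun l => ?_)
    exact (repr_computedElt e l).symm
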